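/- Let $\mathfrak g$ be a real Lie algebra. A para-hypercomplex structure on $\mathfrak g$ is a pair $(J_1,J_2)$ of linear endomorphisms of $\mathfrak g$ with $$J_1^2=-1,\qquad J_2^2=1,\quad J_2\neq\pm1,\qquad J_1J_2=-J_2J_1.$$ It is called integrable if for all $X,Y\in\mathfrak g$ $$[J_1X,J_1Y]-J_1[X,J_1Y]-J_1[J_1X,Y]-[X,Y]=0,$$ $$[J_2X,J_2Y]-J_2[X,J_2Y]-J_2[J_2X,Y]+[X,Y]=0.$$ **Theorem.** Let $\mathfrak g$ be a real Lie algebra of dimension $4$. Then $\mathfrak g$ admits an integrable para-hypercomplex structure if and only if it has a vector space basis $(X,Y,Z,W)$ in which the brackets are given by one of the following (brackets of basis vectors that are not listed, and do not follow from the listed ones by antisymmetry, are zero): * (PHC1) all brackets are zero, i.e. $\mathfrak g$ is abelian; * (PHC2) $[X,Y]=W,\ [Y,W]=-X,\ [W,X]=Y$; * (PHC3) $[X,Y]=Y,\ [X,W]=W$; * (PHC4) $[X,Y]=Z$; * (PHC5) $[X,Y]=X$; * (PHC6) $[X,Y]=Z,\ [X,W]=X+aY+bZ,\ [W,Y]=Y$,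 with $a,b\in\mathbb R$; * (PHC7) $[X,Z]=X,\ [X,W]=Y,\ [Y,Z]=Y,\ [Y,W]=aX+bY$, with $a,b\in\mathbb R$; * (PHC8) $[X,Z]=X,\ [Y,W]=Y$; * (PHC9) $[Z,W]=Z,\ [Y,W]=Y,\ [X,W]=cX+aY+bZ$, with $a,b,c\in\mathbb R$, $c\neq0$; * (PHC10) $[Y,X]=Z,\ [W,Z]=cZ,\ [W,X]=\tfrac12X+aY+bZ,\ [W,Y]=(c-\tfrac12)Y$, with $a,b,c\in\mathbb R$, $c\neq0$. Moreover, for each family and all admissible values of its parameters these relations do define a real Lie algebra. (Different families or parameters may give isomorphic Lie algebras.) -/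

import Mathlib

namespace ParaHypercomplex

section Structures

variable {V : Type*} [AddCommGroup V] [Module ℝ V]

/-- A complex structure on a real vector space: an endomorphism with square `-1`. -/
def IsComplexStructure (J : Module.End ℝ V) : Prop :=
  J * J = -1

/-- A product structure on a real vector space: an endomorphism with square `1`,
different from `1` and from `-1`. -/
def IsProductStructure (J : Module.End ℝ V) : Prop :=
  J * J = 1 ∧ J ≠ 1 ∧ J ≠ -1

/-- A para-hypercomplex structure on a real vector space: an anti-commuting pair of a complex
structure and a product structure. -/
structure IsParaHypercomplex (J₁ J₂ : Module.End ℝ V) : Prop where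
  complex : IsComplexStructure J₁
  product : IsProductStructure J₂
  anticomm : J₁ * J₂ = -(J₂ * J₁)

end Structures

section Integrability

variable {g : Type*} [LieRing g] [LieAlgebra ℝ g]

/-- The Nijenhuis tensor of a complex structure on a Lie algebra. -/
def complexNijenhuis (J : Module.End ℝ g) (X Y : g) : g :=
  ⁅J X, J Y⁆ - J ⁅X, J Y⁆ - J ⁅J X, Y⁆ - ⁅X, Y⁆

/-- The Nijenhuis tensor of a product structure on a Lie algebra. -/
def productNijenhuis (J : Module.End ℝ g) (X Y : g) : g :=
  ⁅J X, J Y⁆ - J ⁅X, J Y⁆ - J ⁅J X, Y⁆ + ⁅X, Y⁆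

/-- An integrable para-hypercomplex structure on a real Lie algebra. -/
structure IsIntegrableParaHypercomplex (J₁ J₂ : Module.End ℝ g) : Prop
    extends IsParaHypercomplex J₁ J₂ where
  integrable₁ : ∀ X Y : g, complexNijenhuis J₁ X Y = 0
  integrable₂ : ∀ X Y : g, productNijenhuis J₂ X Y = 0

end Integrability

/-- The real Lie algebra `g` admits an integrable para-hypercomplex structure. -/
def AdmitsIntegrableParaHypercomplex (g : Type*) [LieRing g] [LieAlgebra ℝ g] : Prop :=
  ∃ J₁ J₂ : Module.End ℝ g, IsIntegrableParaHypercomplex J₁ J₂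

/-- The members of the list: ten families, some of them with real parameters. -/
inductive ListedAlgebra : Type
  | phc1
  | phc2
  | phc3
  | phc4
  | phc5
  | phc6 (a b : ℝ)
  | phc7 (a b : ℝ)
  | phc8
  | phc9 (a b c : ℝ) (hc : c ≠ 0)
  | phc10 (a b c : ℝ) (hc : c ≠ 0)

/-- The commutator relations of a member of the list, for four elements `X`, `Y`, `Z`, `W` of a
Lie algebra. The brackets of all six pairs are given, the vanishing ones included. -/
def ListedAlgebra.Relations {g : Type*} [LieRing g] [LieAlgebra ℝ g]
    (A : ListedAlgebra) (X Y Z W : g) : Prop :=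
  match A with
  | .phc1 =>
      ⁅X, Y⁆ = 0 ∧ ⁅X, Z⁆ = 0 ∧ ⁅X, W⁆ = 0 ∧ ⁅Y, Z⁆ = 0 ∧ ⁅Y, W⁆ = 0 ∧ ⁅Z, W⁆ = 0
  | .phc2 =>
      ⁅X, Y⁆ = W ∧ ⁅Y, W⁆ = -X ∧ ⁅W, X⁆ = Y ∧
      ⁅X, Z⁆ = 0 ∧ ⁅Y, Z⁆ = 0 ∧ ⁅Z, W⁆ = 0
  | .phc3 =>
      ⁅X, Y⁆ = Y ∧ ⁅X, W⁆ = W ∧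
      ⁅X, Z⁆ = 0 ∧ ⁅Y, Z⁆ = 0 ∧ ⁅Y, W⁆ = 0 ∧ ⁅Z, W⁆ = 0
  | .phc4 =>
      ⁅X, Y⁆ = Z ∧
      ⁅X, Z⁆ = 0 ∧ ⁅X, W⁆ = 0 ∧ ⁅Y, Z⁆ = 0 ∧ ⁅Y, W⁆ = 0 ∧ ⁅Z, W⁆ = 0
  | .phc5 =>
      ⁅X, Y⁆ = X ∧
      ⁅X, Z⁆ = 0 ∧ ⁅X, W⁆ = 0 ∧ ⁅Y, Z⁆ = 0 ∧ ⁅Y, W⁆ = 0 ∧ ⁅Z, W⁆ = 0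
  | .phc6 a b =>
      ⁅X, Y⁆ = Z ∧ ⁅X, W⁆ = X + a • Y + b • Z ∧ ⁅W, Y⁆ = Y ∧
      ⁅X, Z⁆ = 0 ∧ ⁅Y, Z⁆ = 0 ∧ ⁅Z, W⁆ = 0
  | .phc7 a b =>
      ⁅X, Z⁆ = X ∧ ⁅X, W⁆ = Y ∧ ⁅Y, Z⁆ = Y ∧ ⁅Y, W⁆ = a • X + b • Y ∧
      ⁅X, Y⁆ = 0 ∧ ⁅Z, W⁆ = 0
  | .phc8 =>
      ⁅X, Z⁆ = X ∧ ⁅Y, W⁆ = Y ∧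
      ⁅X, Y⁆ = 0 ∧ ⁅X, W⁆ = 0 ∧ ⁅Y, Z⁆ = 0 ∧ ⁅Z, W⁆ = 0
  | .phc9 a b c _ =>
      ⁅Z, W⁆ = Z ∧ ⁅Y, W⁆ = Y ∧ ⁅X, W⁆ = c • X + a • Y + b • Z ∧
      ⁅X, Y⁆ = 0 ∧ ⁅X, Z⁆ = 0 ∧ ⁅Y, Z⁆ = 0
  | .phc10 a b c _ =>
      ⁅Y, X⁆ = Z ∧ ⁅W, Z⁆ = c • Z ∧ ⁅W, X⁆ = (1 / 2 : ℝ) • X + a • Y + b • Z ∧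
      ⁅W, Y⁆ = (c - 1 / 2) • Y ∧
      ⁅X, Z⁆ = 0 ∧ ⁅Y, Z⁆ = 0

/-- The real Lie algebra `g` is (isomorphic to) the member `A` of the list: it has a basis
`(X, Y, Z, W)` that satisfies the commutator relations of `A`. -/
def IsListed (g : Type*) [LieRing g] [LieAlgebra ℝ g] (A : ListedAlgebra) : Prop :=
  ∃ e : Module.Basis (Fin 4) ℝ g, A.Relations (e 0) (e 1) (e 2) (e 3)

end ParaHypercomplex

/-!
An integrable para-hypercomplex structure on a four-dimensional Lie algebra `g` is a module structure
over the algebra of real `2 × 2` matrices, so that `g ≅ R ⊗ V` for two real planes `R` and `V`, and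
integrability turns out to mean that `c ⊗ V` is a subalgebra for every `c` in `R`. As `V` is a plane,
`[c ⊗ v, c ⊗ w] = ω(v, w) c ⊗ L c` with an area form `ω` on `V`, and `L : R → V` is linear because the
left hand side is quadratic in `c`. This is the notion of a frame (`IsFrame`, `exists_isFrame_of_integrable`);
conversely every frame carries an integrable structure (`IsFrame.admits`), and each listed algebra has
one (`IsListed.admits`).

It remains to find all frames. What `L` leaves undetermined are three mixed brackets, which are
subject to the Jacobi identity (`IsFrame.jacobi`). The subalgebra `c ⊗ V` acts on `V`, identified with
`g / (c ⊗ V)`; this action controls the solutions, which one finds separately for each rank of `L`.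
* If `L` has rank two, the Jacobi identity forces the vectors `c ⊗ L c` to act by nilpotent
  endomorphisms. If one of them does not act by zero, then `g` is `gl(2, ℝ)` or an extension of the
  Heisenberg algebra; otherwise some element acts as a scalar on an abelian ideal of dimension three
  (`IsFrame.exists_isListed_of_rank_two`).
* If `L` has rank one with image spanned by `q`, then `R ⊗ q` acts by multiples of one nilpotent
  endomorphism, and `g` has a Heisenberg ideal or an abelian ideal of dimension three
  (`IsFrame.exists_isListed_of_rank_one`).
* If `L = 0`, the mixed brackets form a symmetric bilinear map from `V` to `g`. Either some
  decomposable vector acts by an invertible endomorphism, which gives an element acting as the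
  identity on a two-dimensional abelian ideal, or the derived algebra has dimension at most one
  (`IsFrame.exists_isListed_of_rank_zero`).

Three recognition lemmas match these outcomes with the list: `exists_isListed_of_abelian_ideal`,
`exists_isListed_of_heisenberg_ideal` and `exists_isListed_of_scalar_action`.
-/

namespace ParaHypercomplex

/-! ### Generating quadruples -/

section Generates

variable {g : Type*} [AddCommGroup g] [Module ℝ g]

/-- The four vectors generate the real vector space. In dimension `4` this says that they form a
basis; generation is the half that is convenient to check after a change of basis. -/
def Generates (X Y Z W : g) : Prop :=
  ∀ v : g, ∃ a b c d : ℝ, v = a • X + b • Y + c • Z + d • W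

theorem Generates.change {X Y Z W X' Y' Z' W' : g} (h : Generates X Y Z W)
    (hX : ∃ a b c d : ℝ, X = a • X' + b • Y' + c • Z' + d • W')
    (hY : ∃ a b c d : ℝ, Y = a • X' + b • Y' + c • Z' + d • W')
    (hZ : ∃ a b c d : ℝ, Z = a • X' + b • Y' + c • Z' + d • W')
    (hW : ∃ a b c d : ℝ, W = a • X' + b • Y' + c • Z' + d • W') :
    Generates X' Y' Z' W' := by
  obtain ⟨a₁, b₁, c₁, d₁, h₁⟩ := hX
  obtain ⟨a₂, b₂, c₂, d₂, h₂⟩ := hY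
  obtain ⟨a₃, b₃, c₃, d₃, h₃⟩ := hZ
  obtain ⟨a₄, b₄, c₄, d₄, h₄⟩ := hW
  intro v
  obtain ⟨a, b, c, d, hv⟩ := h v
  refine ⟨a * a₁ + b * a₂ + c * a₃ + d * a₄, a * b₁ + b * b₂ + c * b₃ + d * b₄,
    a * c₁ + b * c₂ + c * c₃ + d * c₄, a * d₁ + b * d₂ + c * d₃ + d * d₄, ?_⟩
  rw [hv, h₁, h₂, h₃, h₄]
  module

theorem Generates.exists_basis {X Y Z W : g} (h : Generates X Y Z W)
    (hg : Module.finrank ℝ g = 4) :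
    ∃ e : Module.Basis (Fin 4) ℝ g, e 0 = X ∧ e 1 = Y ∧ e 2 = Z ∧ e 3 = W := by
  have hspan : ⊤ ≤ Submodule.span ℝ (Set.range ![X, Y, Z, W]) := by
    intro v _
    obtain ⟨a, b, c, d, rfl⟩ := h v
    refine (Submodule.mem_span_range_iff_exists_fun ℝ).2 ⟨![a, b, c, d], ?_⟩
    simp [Fin.sum_univ_four]
  refine ⟨basisOfTopLeSpanOfCardEqFinrank ![X, Y, Z, W] hspan (by simp [hg]), ?_⟩
  simp

theorem Generates.eq_zero {X Y Z W : g} (h : Generates X Y Z W)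
    (hg : Module.finrank ℝ g = 4) {a b c d : ℝ}
    (h0 : a • X + b • Y + c • Z + d • W = 0) : a = 0 ∧ b = 0 ∧ c = 0 ∧ d = 0 := by
  obtain ⟨e, rfl, rfl, rfl, rfl⟩ := h.exists_basis hg
  have hs : ∑ i, (![a, b, c, d] : Fin 4 → ℝ) i • e i = 0 := by
    simpa [Fin.sum_univ_four] using h0
  have hi := Fintype.linearIndependent_iff.1 e.linearIndependent _ hs
  exact ⟨hi 0, hi 1, hi 2, hi 3⟩

theorem Generates.of_basis (e : Module.Basis (Fin 4) ℝ g) :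
    Generates (e 0) (e 1) (e 2) (e 3) := fun v ↦
  ⟨e.repr v 0, e.repr v 1, e.repr v 2, e.repr v 3, by
    conv_lhs => rw [← e.sum_repr v]
    rw [Fin.sum_univ_four]⟩

end Generates

/-! ### Recognition of the listed algebras -/

section Recognition

variable {g : Type*} [LieRing g] [LieAlgebra ℝ g]

theorem Generates.isListed {X Y Z W : g} (h : Generates X Y Z W)
    (hg : Module.finrank ℝ g = 4) {A : ListedAlgebra} (hA : A.Relations X Y Z W) :
    IsListed g A := by
  obtain ⟨e, rfl, rfl, rfl, rfl⟩ := h.exists_basis hg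
  exact ⟨e, hA⟩

theorem lie_eq_zero_comm {L : Type*} [LieRing L] {x y : L} (h : ⁅y, x⁆ = 0) : ⁅x, y⁆ = 0 := by
  rw [← lie_skew, h, neg_zero]

/-- An algebra with an abelian ideal `⟨X, Y, Z⟩` of codimension one on which `W` acts as a
scalar plus an endomorphism of rank at most one. -/
theorem exists_isListed_of_abelian_ideal {X Y Z W : g} (hgen : Generates X Y Z W)
    (hg : Module.finrank ℝ g = 4) {k a b c : ℝ}
    (hXY : ⁅X, Y⁆ = 0) (hXZ : ⁅X, Z⁆ = 0) (hYZ : ⁅Y, Z⁆ = 0)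
    (hWX : ⁅W, X⁆ = c • X + a • Y + b • Z) (hWY : ⁅W, Y⁆ = k • Y) (hWZ : ⁅W, Z⁆ = k • Z) :
    ∃ A : ListedAlgebra, IsListed g A := by
  have hYX := lie_eq_zero_comm hXY
  have hZX := lie_eq_zero_comm hXZ
  have hZY := lie_eq_zero_comm hYZ
  have hXW : ⁅X, W⁆ = -(c • X + a • Y + b • Z) := by rw [← lie_skew, hWX]
  have hYW : ⁅Y, W⁆ = -(k • Y) := by rw [← lie_skew, hWY]
  have hZW : ⁅Z, W⁆ = -(k • Z) := by rw [← lie_skew, hWZ]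
  by_cases hk : k = 0
  · subst hk
    by_cases hc : c = 0
    · subst hc
      by_cases ha : a = 0
      · subst ha
        by_cases hb : b = 0
        · subst hb
          refine ⟨.phc1, hgen.isListed hg ⟨hXY, hXZ, ?_, hYZ, ?_, ?_⟩⟩ <;> simp [*]
        · refine ⟨.phc4, Generates.isListed (X := W) (Y := X) (Z := b • Z) (W := Y)
            (hgen.change ⟨0, 1, 0, 0, by module⟩ ⟨0, 0, 0, 1, by module⟩
              ⟨0, 0, b⁻¹, 0, by match_scalars <;> field_simp⟩ ⟨1, 0, 0, 0, by module⟩) hg ?_⟩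
          refine ⟨?_, ?_, ?_, ?_, ?_, ?_⟩ <;> simp [*]
      · refine ⟨.phc4, Generates.isListed (X := W) (Y := X) (Z := a • Y + b • Z) (W := Z)
          (hgen.change ⟨0, 1, 0, 0, by module⟩
            ⟨0, 0, a⁻¹, -(b / a), by match_scalars <;> field_simp <;> ring⟩
            ⟨0, 0, 0, 1, by module⟩ ⟨1, 0, 0, 0, by module⟩) hg ?_⟩
        refine ⟨?_, ?_, ?_, ?_, ?_, ?_⟩ <;> simp [*]
    · refine ⟨.phc5, Generates.isListed (X := c • X + a • Y + b • Z) (Y := -(c⁻¹ • W))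
        (Z := Y) (W := Z)
        (hgen.change ⟨c⁻¹, 0, -(a / c), -(b / c), by match_scalars <;> field_simp <;> ring⟩
          ⟨0, 0, 1, 0, by module⟩ ⟨0, 0, 0, 1, by module⟩
          ⟨0, -c, 0, 0, by match_scalars <;> field_simp <;> ring⟩) hg ?_⟩
      refine ⟨?_, ?_, ?_, ?_, ?_, ?_⟩ <;> simp [*]
  · by_cases hc : c = 0
    · subst hc
      refine ⟨.phc3, Generates.isListed (X := k⁻¹ • W) (Y := Y)
        (Z := X - (a / k) • Y - (b / k) • Z) (W := Z)
        (hgen.change ⟨0, a / k, 1, b / k, by module⟩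
          ⟨0, 1, 0, 0, by module⟩ ⟨0, 0, 0, 1, by module⟩
          ⟨k, 0, 0, 0, by match_scalars <;> field_simp <;> ring⟩) hg ?_⟩
      refine ⟨?_, ?_, ?_, ?_, ?_, ?_⟩ <;> simp [*]
      match_scalars <;> field_simp <;> ring
    · refine ⟨.phc9 (a / k) (b / k) (c / k) (div_ne_zero hc hk),
        Generates.isListed (X := X) (Y := Y) (Z := Z) (W := -(k⁻¹ • W))
        (hgen.change ⟨1, 0, 0, 0, by module⟩ ⟨0, 1, 0, 0, by module⟩ ⟨0, 0, 1, 0, by module⟩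
          ⟨0, 0, 0, -k, by match_scalars <;> field_simp⟩) hg ?_⟩
      refine ⟨?_, ?_, ?_, ?_, ?_, ?_⟩ <;> simp [*]
      match_scalars <;> field_simp

/-- An extension of the Heisenberg algebra `[X, Y] = Z` by a derivation `W` that is triangular
modulo the centre, with a non-zero weight `k` on `X`. -/
theorem exists_isListed_of_heisenberg_ideal_aux {X Y Z W : g} (hgen : Generates X Y Z W)
    (hg : Module.finrank ℝ g = 4) {k m a b : ℝ} (hk : k ≠ 0)
    (hXY : ⁅X, Y⁆ = Z) (hXZ : ⁅X, Z⁆ = 0) (hYZ : ⁅Y, Z⁆ = 0)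
    (hWX : ⁅W, X⁆ = k • X + a • Y + b • Z) (hWY : ⁅W, Y⁆ = m • Y)
    (hWZ : ⁅W, Z⁆ = (k + m) • Z) :
    ∃ A : ListedAlgebra, IsListed g A := by
  have hYX : ⁅Y, X⁆ = -Z := by rw [← lie_skew, hXY]
  have hXW : ⁅X, W⁆ = -(k • X + a • Y + b • Z) := by rw [← lie_skew, hWX]
  have hZW : ⁅Z, W⁆ = -((k + m) • Z) := by rw [← lie_skew, hWZ]
  by_cases hkm : k + m = 0
  · obtain rfl : m = -k := by linarith
    refine ⟨.phc6 (a / k) (b / k),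
      Generates.isListed (X := X) (Y := Y) (Z := Z) (W := -(k⁻¹ • W))
      (hgen.change ⟨1, 0, 0, 0, by module⟩ ⟨0, 1, 0, 0, by module⟩ ⟨0, 0, 1, 0, by module⟩
        ⟨0, 0, 0, -k, by match_scalars <;> field_simp⟩) hg ?_⟩
    refine ⟨?_, ?_, ?_, ?_, ?_, ?_⟩ <;> simp [*]
    match_scalars <;> field_simp
  · refine ⟨.phc10 (a / (2 * k)) (-(b / (2 * k))) ((k + m) / (2 * k))
      (div_ne_zero hkm (by positivity)),
      Generates.isListed (X := X) (Y := Y) (Z := -Z) (W := (2 * k)⁻¹ • W)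
      (hgen.change ⟨1, 0, 0, 0, by module⟩ ⟨0, 1, 0, 0, by module⟩ ⟨0, 0, -1, 0, by module⟩
        ⟨0, 0, 0, 2 * k, by match_scalars <;> field_simp <;> ring⟩) hg ?_⟩
    refine ⟨?_, ?_, ?_, ?_, ?_, ?_⟩ <;> simp [*]
    all_goals match_scalars <;> field_simp <;> ring

/-- An extension of the Heisenberg algebra `[X, Y] = Z` by a derivation `W` that is triangular,
but not nilpotent, modulo the centre. If the weight of `X` vanishes, then the two weights differ,
the derivation can be diagonalised, and `X` and `Y` exchange their roles. -/
theorem exists_isListed_of_heisenberg_ideal {X Y Z W : g} (hgen : Generates X Y Z W)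
    (hg : Module.finrank ℝ g = 4) {k m a b : ℝ} (hkm : k ≠ 0 ∨ m ≠ 0)
    (hXY : ⁅X, Y⁆ = Z) (hXZ : ⁅X, Z⁆ = 0) (hYZ : ⁅Y, Z⁆ = 0)
    (hWX : ⁅W, X⁆ = k • X + a • Y + b • Z) (hWY : ⁅W, Y⁆ = m • Y)
    (hWZ : ⁅W, Z⁆ = (k + m) • Z) :
    ∃ A : ListedAlgebra, IsListed g A := by
  by_cases hk : k = 0
  · subst hk
    have hm : m ≠ 0 := by simpa using hkm
    have hYX : ⁅Y, X⁆ = -Z := by rw [← lie_skew, hXY]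
    have hZY := lie_eq_zero_comm hYZ
    refine exists_isListed_of_heisenberg_ideal_aux (X := Y)
      (Y := X - (a / m) • Y - (b / m) • Z) (Z := -Z) (W := W) (k := m) (m := 0) (a := 0) (b := 0)
      (hgen.change ⟨a / m, 1, -(b / m), 0, by module⟩
        ⟨1, 0, 0, 0, by module⟩ ⟨0, 0, -1, 0, by module⟩ ⟨0, 0, 0, 1, by module⟩)
      hg hm ?_ ?_ ?_ ?_ ?_ ?_ <;> simp [*]
    match_scalars <;> field_simp <;> ring
  · exact exists_isListed_of_heisenberg_ideal_aux hgen hg hk hXY hXZ hYZ hWX hWY hWZ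

theorem exists_isListed_of_scalar_action_aux {X Y Z W : g} (hgen : Generates X Y Z W)
    (hg : Module.finrank ℝ g = 4) {r s t u : ℝ} (hs : s ≠ 0)
    (hXY : ⁅X, Y⁆ = 0) (hZW : ⁅Z, W⁆ = 0) (hXZ : ⁅X, Z⁆ = X) (hYZ : ⁅Y, Z⁆ = Y)
    (hXW : ⁅X, W⁆ = r • X + s • Y) (hYW : ⁅Y, W⁆ = t • X + u • Y) :
    ∃ A : ListedAlgebra, IsListed g A := by
  -- The parameters come from the characteristic polynomial of the action of `W`.
  refine ⟨.phc7 (s * t - r * u) (r + u),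
    Generates.isListed (X := X) (Y := r • X + s • Y) (Z := Z) (W := W)
    (hgen.change ⟨1, 0, 0, 0, by module⟩ ⟨-(r / s), s⁻¹, 0, 0, ?_⟩
      ⟨0, 0, 1, 0, by module⟩ ⟨0, 0, 0, 1, by module⟩) hg ?_⟩
  · match_scalars <;> field_simp <;> ring
  · refine ⟨hXZ, hXW, ?_, ?_, ?_, hZW⟩ <;> simp [*]
    match_scalars <;> ring

/-- An algebra with abelian subalgebras `⟨X, Y⟩`, which is an ideal, and `⟨Z, W⟩`, where `Z` acts
as a scalar on the ideal. Unless `W` acts as a scalar too, the ideal has a vector that is cyclic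
for `W`. -/
theorem exists_isListed_of_scalar_action {X Y Z W : g} (hgen : Generates X Y Z W)
    (hg : Module.finrank ℝ g = 4) {r s t u : ℝ}
    (hXY : ⁅X, Y⁆ = 0) (hZW : ⁅Z, W⁆ = 0) (hXZ : ⁅X, Z⁆ = X) (hYZ : ⁅Y, Z⁆ = Y)
    (hXW : ⁅X, W⁆ = r • X + s • Y) (hYW : ⁅Y, W⁆ = t • X + u • Y) :
    ∃ A : ListedAlgebra, IsListed g A := by
  have hYX := lie_eq_zero_comm hXY
  by_cases hs : s = 0
  · subst hs
    by_cases ht : t = 0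
    · subst ht
      by_cases hru : r = u
      · subst hru
        have hWX : ⁅W, X⁆ = -(r • X + (0 : ℝ) • Y) := by rw [← lie_skew, hXW]
        have hWY : ⁅W, Y⁆ = -((0 : ℝ) • X + r • Y) := by rw [← lie_skew, hYW]
        have hZX : ⁅Z, X⁆ = -X := by rw [← lie_skew, hXZ]
        have hZY : ⁅Z, Y⁆ = -Y := by rw [← lie_skew, hYZ]
        refine ⟨.phc3, Generates.isListed (X := -Z) (Y := X) (Z := W - r • Z) (W := Y)
          (hgen.change ⟨0, 1, 0, 0, by module⟩ ⟨0, 0, 0, 1, by module⟩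
            ⟨-1, 0, 0, 0, by module⟩ ⟨-r, 0, 1, 0, by module⟩) hg ?_⟩
        refine ⟨?_, ?_, ?_, ?_, ?_, ?_⟩ <;> simp [*]
      · refine exists_isListed_of_scalar_action_aux (X := X + Y) (Y := Y) (Z := Z) (W := W)
          (r := r) (s := u - r) (t := 0) (u := u)
          (hgen.change ⟨1, -1, 0, 0, by module⟩ ⟨0, 1, 0, 0, by module⟩
            ⟨0, 0, 1, 0, by module⟩ ⟨0, 0, 0, 1, by module⟩) hg
          (sub_ne_zero.2 (Ne.symm hru)) (by simp [*]) hZW (by simp [*]) hYZ ?_ (by simp [*])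
        rw [add_lie, hXW, hYW]
        module
    · refine exists_isListed_of_scalar_action_aux (X := Y) (Y := X) (Z := Z) (W := W)
        (r := u) (s := t) (t := 0) (u := r)
        (hgen.change ⟨0, 1, 0, 0, by module⟩ ⟨1, 0, 0, 0, by module⟩
          ⟨0, 0, 1, 0, by module⟩ ⟨0, 0, 0, 1, by module⟩) hg ht hYX hZW hYZ hXZ ?_ ?_
      · rw [hYW, add_comm]
      · rw [hXW, add_comm]
  · exact exists_isListed_of_scalar_action_aux hgen hg hs hXY hZW hXZ hYZ hXW hYW

end Recognition

/-! ### Frames -/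

section Frames

variable {g : Type*} [LieRing g] [LieAlgebra ℝ g]

/-- A frame of a four-dimensional Lie algebra: generators `X₁, X₂, Y₁, Y₂`, thought of as the
tensors `a ⊗ p, a ⊗ q, b ⊗ p, b ⊗ q` for bases `(a, b)` and `(p, q)` of two planes `R` and `V`,
such that `[c ⊗ p, c ⊗ q] = c ⊗ L c` for every `c` in `R`, where `L : R → V` is the linear map with
`L a = l₁ p + l₂ q` and `L b = l₃ p + l₄ q`. The three relations are the coefficients of this
identity, which is quadratic in `c`. -/
structure IsFrame (X₁ X₂ Y₁ Y₂ : g) (l₁ l₂ l₃ l₄ : ℝ) : Prop where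
  generates : Generates X₁ X₂ Y₁ Y₂
  lie_X : ⁅X₁, X₂⁆ = l₁ • X₁ + l₂ • X₂
  lie_Y : ⁅Y₁, Y₂⁆ = l₃ • Y₁ + l₄ • Y₂
  lie_XY : ⁅X₁, Y₂⁆ - ⁅X₂, Y₁⁆ = l₃ • X₁ + l₄ • X₂ + l₁ • Y₁ + l₂ • Y₂

variable {X₁ X₂ Y₁ Y₂ : g} {l₁ l₂ l₃ l₄ : ℝ}

/-- Change of the basis `(a, b)` of the first tensor factor. -/
theorem IsFrame.changeLeft (h : IsFrame X₁ X₂ Y₁ Y₂ l₁ l₂ l₃ l₄) {α β γ δ : ℝ}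
    (hd : α * δ - β * γ ≠ 0) :
    IsFrame (α • X₁ + β • Y₁) (α • X₂ + β • Y₂) (γ • X₁ + δ • Y₁) (γ • X₂ + δ • Y₂)
      (α * l₁ + β * l₃) (α * l₂ + β * l₄) (γ * l₁ + δ * l₃) (γ * l₂ + δ * l₄) := by
  obtain ⟨hgen, hX, hY, hXY⟩ := h
  have hXY' : ⁅X₁, Y₂⁆ = ⁅X₂, Y₁⁆ + (l₃ • X₁ + l₄ • X₂ + l₁ • Y₁ + l₂ • Y₂) := by
    rw [← hXY]; abel
  have hYX : ⁅Y₁, X₂⁆ = -⁅X₂, Y₁⁆ := (lie_skew _ _).symm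
  have hX' : ⁅X₂, X₁⁆ = -(l₁ • X₁ + l₂ • X₂) := by rw [← lie_skew, hX]
  have hY' : ⁅Y₂, Y₁⁆ = -(l₃ • Y₁ + l₄ • Y₂) := by rw [← lie_skew, hY]
  have hYX' : ⁅Y₂, X₁⁆ = -(⁅X₂, Y₁⁆ + (l₃ • X₁ + l₄ • X₂ + l₁ • Y₁ + l₂ • Y₂)) := by
    rw [← hXY', lie_skew]
  obtain ⟨i, hi⟩ : ∃ i : ℝ, (α * δ - β * γ) * i = 1 := ⟨_, mul_inv_cancel₀ hd⟩
  refine ⟨hgen.change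
    ⟨δ * i, 0, -β * i, 0, ?_⟩
    ⟨0, δ * i, 0, -β * i, ?_⟩
    ⟨-γ * i, 0, α * i, 0, ?_⟩
    ⟨0, -γ * i, 0, α * i, ?_⟩, ?_, ?_, ?_⟩
  iterate 4 match_scalars <;> first | ring1 | linear_combination -hi
  all_goals
    simp only [add_lie, lie_add, smul_lie, lie_smul, hX, hY, hXY', hYX, hX', hY', hYX']
    module

/-- Change of the basis `(p, q)` of the second tensor factor. -/
theorem IsFrame.changeRight (h : IsFrame X₁ X₂ Y₁ Y₂ l₁ l₂ l₃ l₄) {α β γ δ : ℝ}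
    (hd : α * δ - β * γ ≠ 0) :
    IsFrame (α • X₁ + β • X₂) (γ • X₁ + δ • X₂) (α • Y₁ + β • Y₂) (γ • Y₁ + δ • Y₂)
      (δ * l₁ - γ * l₂) (α * l₂ - β * l₁) (δ * l₃ - γ * l₄) (α * l₄ - β * l₃) := by
  obtain ⟨hgen, hX, hY, hXY⟩ := h
  have hXY' : ⁅X₁, Y₂⁆ = ⁅X₂, Y₁⁆ + (l₃ • X₁ + l₄ • X₂ + l₁ • Y₁ + l₂ • Y₂) := by
    rw [← hXY]; abel
  have hX' : ⁅X₂, X₁⁆ = -(l₁ • X₁ + l₂ • X₂) := by rw [← lie_skew, hX]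
  have hY' : ⁅Y₂, Y₁⁆ = -(l₃ • Y₁ + l₄ • Y₂) := by rw [← lie_skew, hY]
  obtain ⟨i, hi⟩ : ∃ i : ℝ, (α * δ - β * γ) * i = 1 := ⟨_, mul_inv_cancel₀ hd⟩
  refine ⟨hgen.change
    ⟨δ * i, -β * i, 0, 0, ?_⟩
    ⟨-γ * i, α * i, 0, 0, ?_⟩
    ⟨0, 0, δ * i, -β * i, ?_⟩
    ⟨0, 0, -γ * i, α * i, ?_⟩, ?_, ?_, ?_⟩
  iterate 4 match_scalars <;> first | ring1 | linear_combination -hi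
  all_goals
    simp only [add_lie, lie_add, smul_lie, lie_smul, lie_self, hX, hY, hXY', hX', hY']
    module

end Frames

/-! ### Frames and para-hypercomplex structures -/

section Structures

variable {g : Type*} [LieRing g] [LieAlgebra ℝ g]

/-- The eigenspaces of `J₂` are `a ⊗ V` and `b ⊗ V`, and `J₁` maps `a ⊗ v` to `b ⊗ v`. Integrability
of `J₂` says that the eigenspaces are subalgebras, and integrability of `J₁` gives the mixed relation
of a frame. -/
theorem exists_isFrame_of_integrable (hg : Module.finrank ℝ g = 4) {J₁ J₂ : Module.End ℝ g}
    (h : IsIntegrableParaHypercomplex J₁ J₂) :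
    ∃ (X₁ X₂ Y₁ Y₂ : g) (l₁ l₂ l₃ l₄ : ℝ), IsFrame X₁ X₂ Y₁ Y₂ l₁ l₂ l₃ l₄ := by
  have h1 : ∀ x, J₁ (J₁ x) = -x := fun x ↦ by
    simpa using LinearMap.congr_fun h.complex x
  have h2 : ∀ x, J₂ (J₂ x) = x := fun x ↦ by
    simpa using LinearMap.congr_fun h.product.1 x
  have h12 : ∀ x, J₂ (J₁ x) = -J₁ (J₂ x) := fun x ↦ by
    have := LinearMap.congr_fun h.anticomm x
    simp only [Module.End.mul_apply, LinearMap.neg_apply] at this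
    rw [this, neg_neg]
  have hfin : Module.Finite ℝ g := Module.finite_of_finrank_pos (by omega)
  -- `g` is the sum of two copies of the `1`-eigenspace of `J₂`, the second one moved by `J₁`.
  let E : Submodule ℝ g := LinearMap.ker (J₂ - 1)
  have hE : ∀ x, x ∈ E ↔ J₂ x = x := fun x ↦ by
    simp [E, LinearMap.mem_ker, sub_eq_zero]
  let f : (E × E) →ₗ[ℝ] g := E.subtype.coprod (J₁ ∘ₗ E.subtype)
  have hf : ∀ x : E × E, f x = x.1 + J₁ x.2 := fun x ↦ rfl
  have hinj : Function.Injective f := by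
    rw [← LinearMap.ker_eq_bot, LinearMap.ker_eq_bot']
    rintro ⟨⟨x, hx⟩, ⟨y, hy⟩⟩ hxy
    rw [hE] at hx hy
    rw [hf] at hxy
    simp only at hxy
    have hxy' : J₂ (x + J₁ y) = 0 := by rw [hxy, map_zero]
    rw [map_add, h12, hx, hy] at hxy'
    have hx0 : x = 0 := by
      have : (2 : ℝ) • x = 0 := by
        rw [two_smul]
        calc x + x = (x + J₁ y) + (x + -J₁ y) := by abel
          _ = 0 := by rw [hxy, hxy', add_zero]
      simpa using this
    subst hx0
    have hy0 : y = 0 := by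
      rw [zero_add] at hxy
      have := h1 y
      rw [hxy, map_zero] at this
      simpa using this.symm
    subst hy0
    rfl
  have hsurj : Function.Surjective f := by
    intro z
    refine ⟨⟨⟨(1 / 2 : ℝ) • (z + J₂ z), ?_⟩, ⟨-((1 / 2 : ℝ) • J₁ (z - J₂ z)), ?_⟩⟩, ?_⟩
    · rw [hE]
      simp [h2, add_comm]
    · rw [hE]
      simp only [map_neg, map_smul, h12, map_sub, h2]
      module
    · rw [hf]
      simp only [map_neg, map_smul, h1]
      module
  have hdim : Module.finrank ℝ E = 2 := by
    have := (LinearEquiv.ofBijective f ⟨hinj, hsurj⟩).finrank_eq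
    rw [Module.finrank_prod, hg] at this
    omega
  let e := Module.finBasisOfFinrankEq ℝ E hdim
  have hcoord : ∀ x : g, J₂ x = x → ∃ a b : ℝ, x = a • (e 0 : g) + b • (e 1 : g) := by
    intro x hx
    refine ⟨e.repr ⟨x, (hE x).2 hx⟩ 0, e.repr ⟨x, (hE x).2 hx⟩ 1, ?_⟩
    have := congrArg Subtype.val (e.sum_repr ⟨x, (hE x).2 hx⟩)
    rw [Fin.sum_univ_two] at this
    exact this.symm
  set X₁ : g := (e 0 : g) with hX₁
  set X₂ : g := (e 1 : g) with hX₂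
  have hJ₁ : J₂ X₁ = X₁ := (hE _).1 (e 0).2
  have hJ₂ : J₂ X₂ = X₂ := (hE _).1 (e 1).2
  obtain ⟨l₁, l₂, hl⟩ := hcoord ⁅X₁, X₂⁆ (by
    have := h.integrable₂ X₁ X₂
    rw [productNijenhuis, hJ₁, hJ₂] at this
    have h2' : (2 : ℝ) • (⁅X₁, X₂⁆ - J₂ ⁅X₁, X₂⁆) = 0 := by
      rw [← this]; module
    exact (sub_eq_zero.1 ((smul_eq_zero.1 h2').resolve_left two_ne_zero)).symm)
  have hY : J₂ ⁅J₁ X₁, J₁ X₂⁆ = -⁅J₁ X₁, J₁ X₂⁆ := by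
    have := h.integrable₂ (J₁ X₁) (J₁ X₂)
    rw [productNijenhuis, h12, h12, hJ₁, hJ₂] at this
    simp only [neg_lie, lie_neg, neg_neg, map_neg] at this
    have h2' : (2 : ℝ) • (⁅J₁ X₁, J₁ X₂⁆ + J₂ ⁅J₁ X₁, J₁ X₂⁆) = 0 := by
      rw [← this]; module
    exact (neg_eq_of_add_eq_zero_right
      ((smul_eq_zero.1 h2').resolve_left two_ne_zero)).symm
  obtain ⟨l₃, l₄, hl'⟩ := hcoord (-J₁ ⁅J₁ X₁, J₁ X₂⁆) (by rw [map_neg, h12, hY, map_neg, neg_neg])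
  refine ⟨X₁, X₂, J₁ X₁, J₁ X₂, l₁, l₂, l₃, l₄, ?_, hl, ?_, ?_⟩
  · intro v
    obtain ⟨⟨⟨x, hx⟩, ⟨y, hy⟩⟩, rfl⟩ := hsurj v
    obtain ⟨a, b, hab⟩ := hcoord x ((hE x).1 hx)
    obtain ⟨c, d, hcd⟩ := hcoord y ((hE y).1 hy)
    refine ⟨a, b, c, d, ?_⟩
    rw [hf]
    simp only
    rw [hab, hcd, map_add, map_smul, map_smul]
    module
  · have := congrArg J₁ hl'
    rw [map_neg, h1, neg_neg] at this
    rw [this, map_add, map_smul, map_smul]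
  · have hN := congrArg J₁ (h.integrable₁ X₁ X₂)
    rw [complexNijenhuis, map_zero, map_sub, map_sub, map_sub, h1, h1, hl, map_add, map_smul,
      map_smul] at hN
    have hs : ⁅X₂, J₁ X₁⁆ = -⁅J₁ X₁, X₂⁆ := (lie_skew _ _).symm
    rw [neg_eq_iff_eq_neg] at hl'
    rw [hl'] at hN
    rw [hs, ← sub_eq_zero, ← hN]
    module

/-- The structure is `J₁ (a ⊗ v) = b ⊗ v`, `J₁ (b ⊗ v) = -(a ⊗ v)`, and `J₂` is the identity on
`a ⊗ V` and minus the identity on `b ⊗ V`. -/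
theorem IsFrame.admits (hg : Module.finrank ℝ g = 4) {X₁ X₂ Y₁ Y₂ : g} {l₁ l₂ l₃ l₄ : ℝ}
    (h : IsFrame X₁ X₂ Y₁ Y₂ l₁ l₂ l₃ l₄) : AdmitsIntegrableParaHypercomplex g := by
  obtain ⟨hgen, hX, hY, hXY⟩ := h
  obtain ⟨e, h0, h1, h2, h3⟩ := hgen.exists_basis hg
  have hXY' : ⁅X₁, Y₂⁆ = ⁅X₂, Y₁⁆ + (l₃ • X₁ + l₄ • X₂ + l₁ • Y₁ + l₂ • Y₂) := by
    rw [← hXY]; abel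
  have hYX : ⁅Y₁, X₂⁆ = -⁅X₂, Y₁⁆ := (lie_skew _ _).symm
  have hYX₁ : ⁅Y₁, X₁⁆ = -⁅X₁, Y₁⁆ := (lie_skew _ _).symm
  have hYX₂ : ⁅Y₂, X₂⁆ = -⁅X₂, Y₂⁆ := (lie_skew _ _).symm
  have hX' : ⁅X₂, X₁⁆ = -(l₁ • X₁ + l₂ • X₂) := by rw [← lie_skew, hX]
  have hY' : ⁅Y₂, Y₁⁆ = -(l₃ • Y₁ + l₄ • Y₂) := by rw [← lie_skew, hY]
  have hYX' : ⁅Y₂, X₁⁆ = -(⁅X₂, Y₁⁆ + (l₃ • X₁ + l₄ • X₂ + l₁ • Y₁ + l₂ • Y₂)) := by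
    rw [← hXY', lie_skew]
  let J₁ : Module.End ℝ g := e.constr ℝ ![Y₁, Y₂, -X₁, -X₂]
  let J₂ : Module.End ℝ g := e.constr ℝ ![X₁, X₂, -Y₁, -Y₂]
  have a0 : J₁ X₁ = Y₁ := by rw [← h0]; simp [J₁]
  have a1 : J₁ X₂ = Y₂ := by rw [← h1]; simp [J₁]
  have a2 : J₁ Y₁ = -X₁ := by rw [← h2]; simp [J₁]
  have a3 : J₁ Y₂ = -X₂ := by rw [← h3]; simp [J₁]
  have b0 : J₂ X₁ = X₁ := by nth_rewrite 1 [← h0]; simp [J₂]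
  have b1 : J₂ X₂ = X₂ := by nth_rewrite 1 [← h1]; simp [J₂]
  have b2 : J₂ Y₁ = -Y₁ := by nth_rewrite 1 [← h2]; simp [J₂]
  have b3 : J₂ Y₂ = -Y₂ := by nth_rewrite 1 [← h3]; simp [J₂]
  have hext : ∀ f f' : Module.End ℝ g, f X₁ = f' X₁ → f X₂ = f' X₂ → f Y₁ = f' Y₁ →
      f Y₂ = f' Y₂ → f = f' := by
    intro f f' e0 e1 e2 e3
    refine e.ext fun i ↦ ?_
    fin_cases i <;> simp_all
  have hself : ∀ v : g, -v = v → v = 0 := by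
    intro v hv
    have : (2 : ℝ) • v = 0 := by
      rw [two_smul]
      nth_rewrite 1 [← hv]
      exact neg_add_cancel v
    simpa using this
  have hne : X₁ ≠ 0 := h0 ▸ e.ne_zero 0
  have hne' : Y₁ ≠ 0 := h2 ▸ e.ne_zero 2
  refine ⟨J₁, J₂, ⟨⟨?_, ⟨?_, ?_, ?_⟩, ?_⟩, ?_, ?_⟩⟩
  · exact hext _ _ (by simp [*]) (by simp [*]) (by simp [*]) (by simp [*])
  · exact hext _ _ (by simp [*]) (by simp [*]) (by simp [*]) (by simp [*])
  · intro hJ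
    have := LinearMap.congr_fun hJ Y₁
    rw [b2, Module.End.one_apply] at this
    exact hne' (hself Y₁ this)
  · intro hJ
    have := LinearMap.congr_fun hJ X₁
    rw [b0, LinearMap.neg_apply, Module.End.one_apply] at this
    exact hne (hself X₁ this.symm)
  · exact hext _ _ (by simp [*]) (by simp [*]) (by simp [*]) (by simp [*])
  · intro x y
    obtain ⟨x₁, x₂, x₃, x₄, rfl⟩ := hgen x
    obtain ⟨y₁, y₂, y₃, y₄, rfl⟩ := hgen y
    simp only [complexNijenhuis, map_add, map_smul, a0, a1, a2, a3, add_lie, lie_add, smul_lie,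
      lie_smul, lie_self, neg_lie, lie_neg, smul_neg, map_neg, hX, hY, hXY', hYX, hYX₁, hYX₂, hX',
      hY', hYX', smul_zero, map_zero]
    module
  · intro x y
    obtain ⟨x₁, x₂, x₃, x₄, rfl⟩ := hgen x
    obtain ⟨y₁, y₂, y₃, y₄, rfl⟩ := hgen y
    simp only [productNijenhuis, map_add, map_smul, b0, b1, b2, b3, add_lie, lie_add, smul_lie,
      lie_smul, lie_self, neg_lie, lie_neg, smul_neg, map_neg, hX, hY, hXY', hYX, hYX₁, hYX₂, hX',
      hY', hYX', smul_zero, map_zero]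
    module

end Structures

/-! ### Frames of the listed algebras -/

section Listed

variable {g : Type*} [LieRing g] [LieAlgebra ℝ g]

theorem IsListed.admits (hg : Module.finrank ℝ g = 4) {A : ListedAlgebra} (h : IsListed g A) :
    AdmitsIntegrableParaHypercomplex g := by
  obtain ⟨e, he⟩ := h
  have hgen := Generates.of_basis e
  revert he hgen
  generalize e 0 = X
  generalize e 1 = Y
  generalize e 2 = Z
  generalize e 3 = W
  intro he hgen
  have hYX : ⁅Y, X⁆ = -⁅X, Y⁆ := (lie_skew _ _).symm
  have hZX : ⁅Z, X⁆ = -⁅X, Z⁆ := (lie_skew _ _).symm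
  have hWX : ⁅W, X⁆ = -⁅X, W⁆ := (lie_skew _ _).symm
  have hZY : ⁅Z, Y⁆ = -⁅Y, Z⁆ := (lie_skew _ _).symm
  have hWY : ⁅W, Y⁆ = -⁅Y, W⁆ := (lie_skew _ _).symm
  have hWZ : ⁅W, Z⁆ = -⁅Z, W⁆ := (lie_skew _ _).symm
  cases A with
  | phc1 =>
    obtain ⟨h1, h2, h3, h4, h5, h6⟩ := he
    refine IsFrame.admits hg (X₁ := X) (X₂ := Y) (Y₁ := Z) (Y₂ := W)
      (l₁ := 0) (l₂ := 0) (l₃ := 0) (l₄ := 0) ⟨hgen, ?_, ?_, ?_⟩ <;> simp [*]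
  | phc2 =>
    obtain ⟨h1, h2, h3, h4, h5, h6⟩ := he
    rw [hWX, neg_eq_iff_eq_neg] at h3
    -- The matrix units of `gl(2, ℝ)`, with `Z` as half of the identity matrix.
    refine IsFrame.admits hg (X₁ := X - Y) (X₂ := W + Z) (Y₁ := W - Z) (Y₂ := X + Y)
      (l₁ := 1) (l₂ := 0) (l₃ := 0) (l₄ := 1) ⟨hgen.change
      ⟨1 / 2, 0, 0, 1 / 2, by module⟩ ⟨-1 / 2, 0, 0, 1 / 2, by module⟩
      ⟨0, 1 / 2, -1 / 2, 0, by module⟩ ⟨0, 1 / 2, 1 / 2, 0, by module⟩, ?_, ?_, ?_⟩ <;>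
    simp only [sub_lie, add_lie, lie_add, lie_sub, lie_self, hYX, hZX, hWX, hZY, hWY, hWZ, h1, h2,
      h3, h4, h5, h6] <;> module
  | phc3 =>
    obtain ⟨h1, h2, h3, h4, h5, h6⟩ := he
    refine IsFrame.admits hg (X₁ := Z) (X₂ := Y) (Y₁ := X) (Y₂ := W)
      (l₁ := 0) (l₂ := 0) (l₃ := 0) (l₄ := 1) ⟨hgen.change
      ⟨0, 0, 1, 0, by module⟩ ⟨0, 1, 0, 0, by module⟩
      ⟨1, 0, 0, 0, by module⟩ ⟨0, 0, 0, 1, by module⟩, ?_, ?_, ?_⟩ <;> simp [*]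
  | phc4 =>
    obtain ⟨h1, h2, h3, h4, h5, h6⟩ := he
    refine IsFrame.admits hg (X₁ := X) (X₂ := Z) (Y₁ := Y) (Y₂ := W)
      (l₁ := 0) (l₂ := 0) (l₃ := 0) (l₄ := 0) ⟨hgen.change
      ⟨1, 0, 0, 0, by module⟩ ⟨0, 0, 1, 0, by module⟩
      ⟨0, 1, 0, 0, by module⟩ ⟨0, 0, 0, 1, by module⟩, ?_, ?_, ?_⟩ <;> simp [*]
  | phc5 =>
    obtain ⟨h1, h2, h3, h4, h5, h6⟩ := he
    refine IsFrame.admits hg (X₁ := X) (X₂ := Z) (Y₁ := Y) (Y₂ := W)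
      (l₁ := 0) (l₂ := 0) (l₃ := 0) (l₄ := 0) ⟨hgen.change
      ⟨1, 0, 0, 0, by module⟩ ⟨0, 0, 1, 0, by module⟩
      ⟨0, 1, 0, 0, by module⟩ ⟨0, 0, 0, 1, by module⟩, ?_, ?_, ?_⟩ <;> simp [*]
  | phc6 a b =>
    obtain ⟨h1, h2, h3, h4, h5, h6⟩ := he
    rw [hWY, neg_eq_iff_eq_neg] at h3
    refine IsFrame.admits hg (X₁ := X) (X₂ := Z) (Y₁ := W) (Y₂ := Y)
      (l₁ := 0) (l₂ := 0) (l₃ := 0) (l₄ := 1) ⟨hgen.change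
      ⟨1, 0, 0, 0, by module⟩ ⟨0, 0, 0, 1, by module⟩
      ⟨0, 1, 0, 0, by module⟩ ⟨0, 0, 1, 0, by module⟩, ?_, ?_, ?_⟩ <;> simp [*]
  | phc7 a b =>
    obtain ⟨h1, h2, h3, h4, h5, h6⟩ := he
    refine IsFrame.admits hg (X₁ := Z) (X₂ := W) (Y₁ := X) (Y₂ := Y)
      (l₁ := 0) (l₂ := 0) (l₃ := 0) (l₄ := 0) ⟨hgen.change
      ⟨0, 0, 1, 0, by module⟩ ⟨0, 0, 0, 1, by module⟩
      ⟨1, 0, 0, 0, by module⟩ ⟨0, 1, 0, 0, by module⟩, ?_, ?_, ?_⟩ <;> simp [*]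
  | phc8 =>
    obtain ⟨h1, h2, h3, h4, h5, h6⟩ := he
    refine IsFrame.admits hg (X₁ := Z) (X₂ := W) (Y₁ := X) (Y₂ := Y)
      (l₁ := 0) (l₂ := 0) (l₃ := 0) (l₄ := 0) ⟨hgen.change
      ⟨0, 0, 1, 0, by module⟩ ⟨0, 0, 0, 1, by module⟩
      ⟨1, 0, 0, 0, by module⟩ ⟨0, 1, 0, 0, by module⟩, ?_, ?_, ?_⟩ <;> simp [*]
  | phc9 a b c hc =>
    obtain ⟨h1, h2, h3, h4, h5, h6⟩ := he
    refine IsFrame.admits hg (X₁ := X) (X₂ := Y) (Y₁ := -W) (Y₂ := Z)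
      (l₁ := 0) (l₂ := 0) (l₃ := 0) (l₄ := 1) ⟨hgen.change
      ⟨1, 0, 0, 0, by module⟩ ⟨0, 1, 0, 0, by module⟩
      ⟨0, 0, 0, 1, by module⟩ ⟨0, 0, -1, 0, by module⟩, ?_, ?_, ?_⟩ <;> simp [*]
  | phc10 a b c hc =>
    obtain ⟨h1, h2, h3, h4, h5, h6⟩ := he
    rw [hYX, neg_eq_iff_eq_neg] at h1
    rw [hWZ, neg_eq_iff_eq_neg] at h2
    rw [hWX, neg_eq_iff_eq_neg] at h3
    rw [hWY, neg_eq_iff_eq_neg] at h4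
    by_cases hc' : c - 1 / 2 = 0
    -- `W` and `Y` commute, and `W` acts on the abelian ideal `⟨X, Z⟩` as a scalar modulo `Y`.
    · obtain rfl : c = 1 / 2 := by linarith
      refine IsFrame.admits hg (X₁ := W) (X₂ := Y) (Y₁ := X) (Y₂ := (2 : ℝ) • Z)
        (l₁ := 0) (l₂ := 0) (l₃ := 0) (l₄ := 0) ⟨hgen.change
        ⟨0, 0, 1, 0, by module⟩ ⟨0, 1, 0, 0, by module⟩
        ⟨0, 0, 0, 1 / 2, by module⟩ ⟨1, 0, 0, 0, by module⟩, ?_, ?_, ?_⟩ <;> simp [*]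
    · have hc2 : 2 * c - 1 ≠ 0 := fun h ↦ hc' (by linarith)
      obtain ⟨i, hi⟩ : ∃ i : ℝ, i * (c - 1 / 2) = 1 := ⟨_, inv_mul_cancel₀ hc'⟩
      refine IsFrame.admits hg (X₁ := X) (X₂ := (2 * c - 1) • Z) (Y₁ := i • W)
        (Y₂ := Y) (l₁ := 0) (l₂ := 0) (l₃ := 0) (l₄ := 1) ⟨hgen.change
        ⟨1, 0, 0, 0, by module⟩ ⟨0, 0, 0, 1, by module⟩
        ⟨0, (2 * c - 1)⁻¹, 0, 0, by simp only [smul_smul, inv_mul_cancel₀ hc2]; module⟩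
        ⟨0, 0, c - 1 / 2, 0, by
          rw [smul_smul (c - 1 / 2), mul_comm (c - 1 / 2), hi]; module⟩,
        ?_, ?_, ?_⟩
      · simp [*]
      · simp only [smul_lie, hWY, h4, neg_neg, smul_smul, hi]; module
      · simp only [smul_lie, lie_smul, h1, h2, smul_neg, smul_smul]
        match_scalars <;> first | ring1 | linear_combination 2 * c * hi

end Listed

/-! ### The listed algebras exist -/

/-- The underlying space `ℝ⁴` of the Lie algebra with the relations of a member of the list. -/
def Model (_ : ListedAlgebra) : Type := Fin 4 → ℝ

namespace Model

noncomputable instance (A : ListedAlgebra) : AddCommGroup (Model A) :=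
  inferInstanceAs (AddCommGroup (Fin 4 → ℝ))

noncomputable instance (A : ListedAlgebra) : Module ℝ (Model A) :=
  inferInstanceAs (Module ℝ (Fin 4 → ℝ))

theorem add_apply {A : ListedAlgebra} (x y : Model A) (i : Fin 4) :
    (x + y) i = x i + y i := rfl

theorem neg_apply {A : ListedAlgebra} (x : Model A) (i : Fin 4) : (-x) i = -x i := rfl

theorem zero_apply {A : ListedAlgebra} (i : Fin 4) : (0 : Model A) i = 0 := rfl

theorem smul_apply {A : ListedAlgebra} (t : ℝ) (x : Model A) (i : Fin 4) :
    (t • x) i = t * x i := rfl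

/-- The standard basis of `ℝ⁴`. -/
noncomputable def basis (A : ListedAlgebra) : Module.Basis (Fin 4) ℝ (Model A) :=
  Pi.basisFun ℝ (Fin 4)

theorem basis_apply {A : ListedAlgebra} (i j : Fin 4) :
    basis A i j = if j = i then 1 else 0 := by
  change (Pi.basisFun ℝ (Fin 4)) i j = _
  rw [Pi.basisFun_apply, Pi.single_apply]

/-- The brackets of the standard basis vectors, for the pairs
`(0, 1), (0, 2), (0, 3), (1, 2), (1, 3), (2, 3)`. -/
noncomputable def structureConstants : ListedAlgebra → Fin 6 → Fin 4 → ℝ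
  | .phc1 => ![![0, 0, 0, 0], ![0, 0, 0, 0], ![0, 0, 0, 0],
      ![0, 0, 0, 0], ![0, 0, 0, 0], ![0, 0, 0, 0]]
  | .phc2 => ![![0, 0, 0, 1], ![0, 0, 0, 0], ![0, -1, 0, 0],
      ![0, 0, 0, 0], ![-1, 0, 0, 0], ![0, 0, 0, 0]]
  | .phc3 => ![![0, 1, 0, 0], ![0, 0, 0, 0], ![0, 0, 0, 1],
      ![0, 0, 0, 0], ![0, 0, 0, 0], ![0, 0, 0, 0]]
  | .phc4 => ![![0, 0, 1, 0], ![0, 0, 0, 0], ![0, 0, 0, 0],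
      ![0, 0, 0, 0], ![0, 0, 0, 0], ![0, 0, 0, 0]]
  | .phc5 => ![![1, 0, 0, 0], ![0, 0, 0, 0], ![0, 0, 0, 0],
      ![0, 0, 0, 0], ![0, 0, 0, 0], ![0, 0, 0, 0]]
  | .phc6 a b => ![![0, 0, 1, 0], ![0, 0, 0, 0], ![1, a, b, 0],
      ![0, 0, 0, 0], ![0, -1, 0, 0], ![0, 0, 0, 0]]
  | .phc7 a b => ![![0, 0, 0, 0], ![1, 0, 0, 0], ![0, 1, 0, 0],
      ![0, 1, 0, 0], ![a, b, 0, 0], ![0, 0, 0, 0]]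
  | .phc8 => ![![0, 0, 0, 0], ![1, 0, 0, 0], ![0, 0, 0, 0],
      ![0, 0, 0, 0], ![0, 1, 0, 0], ![0, 0, 0, 0]]
  | .phc9 a b c _ => ![![0, 0, 0, 0], ![0, 0, 0, 0], ![c, a, b, 0],
      ![0, 0, 0, 0], ![0, 1, 0, 0], ![0, 0, 1, 0]]
  | .phc10 a b c _ => ![![0, 0, -1, 0], ![0, 0, 0, 0], ![-(1 / 2), -a, -b, 0],
      ![0, 0, 0, 0], ![0, -(c - 1 / 2), 0, 0], ![0, 0, -c, 0]]

/-- The alternating product with the given structure constants. -/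
noncomputable def bracket (A : ListedAlgebra) (x y : Fin 4 → ℝ) : Fin 4 → ℝ := fun i ↦
  (x 0 * y 1 - x 1 * y 0) * structureConstants A 0 i +
  (x 0 * y 2 - x 2 * y 0) * structureConstants A 1 i +
  (x 0 * y 3 - x 3 * y 0) * structureConstants A 2 i +
  (x 1 * y 2 - x 2 * y 1) * structureConstants A 3 i +
  (x 1 * y 3 - x 3 * y 1) * structureConstants A 4 i +
  (x 2 * y 3 - x 3 * y 2) * structureConstants A 5 i

theorem bracket_jacobi (A : ListedAlgebra) (x y z : Fin 4 → ℝ) :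
    bracket A x (bracket A y z) = bracket A (bracket A x y) z + bracket A y (bracket A x z) := by
  funext i
  cases A <;> fin_cases i <;> simp [bracket, structureConstants] <;> ring

noncomputable instance (A : ListedAlgebra) : LieRing (Model A) where
  bracket x y := bracket A x y
  add_lie x y z := funext fun i ↦ by
    change bracket A (x + y) z i = bracket A x z i + bracket A y z i
    simp only [bracket, add_apply]
    ring
  lie_add x y z := funext fun i ↦ by
    change bracket A x (y + z) i = bracket A x y i + bracket A x z i
    simp only [bracket, add_apply]
    ring
  lie_self x := funext fun i ↦ by
    change bracket A x x i = 0
    simp only [bracket]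
    ring
  leibniz_lie x y z := bracket_jacobi A x y z

noncomputable instance (A : ListedAlgebra) : LieAlgebra ℝ (Model A) where
  lie_smul t x y := funext fun i ↦ by
    change bracket A x (t • y) i = t * bracket A x y i
    simp only [bracket, smul_apply]
    ring

theorem lie_apply {A : ListedAlgebra} (x y : Model A) (i : Fin 4) :
    ⁅x, y⁆ i = bracket A x y i := rfl

theorem isListed (A : ListedAlgebra) : IsListed (Model A) A := by
  refine ⟨basis A, ?_⟩
  cases A <;> refine ⟨?_, ?_, ?_, ?_, ?_, ?_⟩ <;> funext i <;>
    simp only [lie_apply, add_apply, neg_apply, zero_apply, smul_apply, bracket, basis_apply] <;>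
    fin_cases i <;> simp [structureConstants]

end Model

/-! ### The Jacobi identity in a frame -/

section Jacobi

variable {g : Type*} [LieRing g] [LieAlgebra ℝ g] {X₁ X₂ Y₁ Y₂ : g} {l₁ l₂ l₃ l₄ : ℝ}
  {p₁ p₂ p₃ p₄ r₁ r₂ r₃ r₄ s₁ s₂ s₃ s₄ : ℝ}

theorem IsFrame.lie_X₁_Y₂ (h : IsFrame X₁ X₂ Y₁ Y₂ l₁ l₂ l₃ l₄)
    (hR : ⁅X₂, Y₁⁆ = r₁ • X₁ + r₂ • X₂ + r₃ • Y₁ + r₄ • Y₂) :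
    ⁅X₁, Y₂⁆ = (r₁ + l₃) • X₁ + (r₂ + l₄) • X₂ + (r₃ + l₁) • Y₁ + (r₄ + l₂) • Y₂ := by
  rw [eq_add_of_sub_eq h.lie_XY, hR]
  module

/-- The Jacobi identity for the triples `(X₁, X₂, Y₁)`, `(X₁, X₂, Y₂)`, `(Y₁, Y₂, X₁)` and
`(Y₁, Y₂, X₂)`, in coordinates. -/
theorem IsFrame.jacobi (h : IsFrame X₁ X₂ Y₁ Y₂ l₁ l₂ l₃ l₄) (hg : Module.finrank ℝ g = 4)
    (hP : ⁅X₁, Y₁⁆ = p₁ • X₁ + p₂ • X₂ + p₃ • Y₁ + p₄ • Y₂)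
    (hR : ⁅X₂, Y₁⁆ = r₁ • X₁ + r₂ • X₂ + r₃ • Y₁ + r₄ • Y₂)
    (hS : ⁅X₂, Y₂⁆ = s₁ • X₁ + s₂ • X₂ + s₃ • Y₁ + s₄ • Y₂) :
    ((r₂ + p₁) * l₁ + (r₃ - l₁) * p₁ + r₄ * (r₁ + l₃) - (p₃ + l₂) * r₁ - p₄ * s₁ = 0 ∧
      (r₂ + p₁) * l₂ + (r₃ - l₁) * p₂ + r₄ * (r₂ + l₄) - (p₃ + l₂) * r₂ - p₄ * s₂ = 0 ∧
      (r₃ - l₁) * p₃ + r₄ * (r₃ + l₁) - (p₃ + l₂) * r₃ - p₄ * s₃ = 0 ∧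
      (r₃ - l₁) * p₄ + r₄ * (r₄ + l₂) - (p₃ + l₂) * r₄ - p₄ * s₄ = 0) ∧
    ((s₂ + (r₁ + l₃)) * l₁ + s₃ * p₁ + (s₄ - l₁) * (r₁ + l₃) - (r₃ + l₁) * r₁ -
      ((r₄ + l₂) + l₂) * s₁ = 0 ∧
      (s₂ + (r₁ + l₃)) * l₂ + s₃ * p₂ + (s₄ - l₁) * (r₂ + l₄) - (r₃ + l₁) * r₂ -
        ((r₄ + l₂) + l₂) * s₂ = 0 ∧
      s₃ * p₃ + (s₄ - l₁) * (r₃ + l₁) - (r₃ + l₁) * r₃ - ((r₄ + l₂) + l₂) * s₃ = 0 ∧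
      s₃ * p₄ + (s₄ - l₁) * (r₄ + l₂) - (r₃ + l₁) * r₄ - ((r₄ + l₂) + l₂) * s₄ = 0) ∧
    (-(r₁ + l₃ + l₃) * p₁ + (p₁ - l₄) * (r₁ + l₃) - (r₂ + l₄) * r₁ + p₂ * s₁ = 0 ∧
      -(r₁ + l₃ + l₃) * p₂ + (p₁ - l₄) * (r₂ + l₄) - (r₂ + l₄) * r₂ + p₂ * s₂ = 0 ∧
      (p₃ + (r₄ + l₂)) * l₃ - (r₁ + l₃ + l₃) * p₃ + (p₁ - l₄) * (r₃ + l₁) - (r₂ + l₄) * r₃ +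
        p₂ * s₃ = 0 ∧
      (p₃ + (r₄ + l₂)) * l₄ - (r₁ + l₃ + l₃) * p₄ + (p₁ - l₄) * (r₄ + l₂) - (r₂ + l₄) * r₄ +
        p₂ * s₄ = 0) ∧
    (-s₁ * p₁ + r₁ * (r₁ + l₃) - (s₂ + l₃) * r₁ + (r₂ - l₄) * s₁ = 0 ∧
      -s₁ * p₂ + r₁ * (r₂ + l₄) - (s₂ + l₃) * r₂ + (r₂ - l₄) * s₂ = 0 ∧
      (r₃ + s₄) * l₃ - s₁ * p₃ + r₁ * (r₃ + l₁) - (s₂ + l₃) * r₃ + (r₂ - l₄) * s₃ = 0 ∧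
      (r₃ + s₄) * l₄ - s₁ * p₄ + r₁ * (r₄ + l₂) - (s₂ + l₃) * r₄ + (r₂ - l₄) * s₄ = 0) := by
  have hQ := h.lie_X₁_Y₂ hR
  have hX := h.lie_X
  have hY := h.lie_Y
  have hX' : ⁅X₂, X₁⁆ = -(l₁ • X₁ + l₂ • X₂) := by rw [← lie_skew, hX]
  have hY' : ⁅Y₂, Y₁⁆ = -(l₃ • Y₁ + l₄ • Y₂) := by rw [← lie_skew, hY]
  have hP' : ⁅Y₁, X₁⁆ = -(p₁ • X₁ + p₂ • X₂ + p₃ • Y₁ + p₄ • Y₂) := by rw [← lie_skew, hP]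
  have hQ' : ⁅Y₂, X₁⁆ = -((r₁ + l₃) • X₁ + (r₂ + l₄) • X₂ + (r₃ + l₁) • Y₁ +
      (r₄ + l₂) • Y₂) := by rw [← lie_skew, hQ]
  have hR' : ⁅Y₁, X₂⁆ = -(r₁ • X₁ + r₂ • X₂ + r₃ • Y₁ + r₄ • Y₂) := by rw [← lie_skew, hR]
  have hS' : ⁅Y₂, X₂⁆ = -(s₁ • X₁ + s₂ • X₂ + s₃ • Y₁ + s₄ • Y₂) := by rw [← lie_skew, hS]
  refine ⟨?_, ?_, ?_, ?_⟩
  · refine h.generates.eq_zero hg ?_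
    rw [← sub_eq_zero.2 (leibniz_lie X₁ X₂ Y₁)]
    simp only [add_lie, lie_add, smul_lie, lie_smul, lie_self, hX, hP, hQ, hR, hS, hX']
    module
  · refine h.generates.eq_zero hg ?_
    rw [← sub_eq_zero.2 (leibniz_lie X₁ X₂ Y₂)]
    simp only [add_lie, lie_add, smul_lie, lie_smul, lie_self, hX, hP, hQ, hR, hS, hX']
    module
  · refine h.generates.eq_zero hg ?_
    rw [← sub_eq_zero.2 (leibniz_lie Y₁ Y₂ X₁).symm]
    simp only [add_lie, lie_add, smul_lie, lie_smul, lie_neg, lie_self, hY, hY', hP',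
      hQ', hR', hS']
    module
  · refine h.generates.eq_zero hg ?_
    rw [← sub_eq_zero.2 (leibniz_lie Y₁ Y₂ X₂).symm]
    simp only [add_lie, lie_add, smul_lie, lie_smul, lie_neg, lie_self, hY, hY', hP',
      hQ', hR', hS']
    module

end Jacobi

/-! ### Frames with `L` of rank one -/

section RankOne

variable {g : Type*} [LieRing g] [LieAlgebra ℝ g] {X₁ X₂ Y₁ Y₂ : g}

/-- The case `L a = 0`, `L b = q`. The action of `R ⊗ q` on `V` is by multiples of one nilpotent
endomorphism, which either kills `q` or may be assumed to kill `p`. -/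
theorem IsFrame.exists_isListed_of_rank_one (h : IsFrame X₁ X₂ Y₁ Y₂ 0 0 0 1)
    (hg : Module.finrank ℝ g = 4) : ∃ A : ListedAlgebra, IsListed g A := by
  obtain ⟨p₁, p₂, p₃, p₄, hP⟩ := h.generates ⁅X₁, Y₁⁆
  obtain ⟨r₁, r₂, r₃, r₄, hR⟩ := h.generates ⁅X₂, Y₁⁆
  obtain ⟨s₁, s₂, s₃, s₄, hS⟩ := h.generates ⁅X₂, Y₂⁆
  by_cases hs₁ : s₁ = 0
  · have hQ := h.lie_X₁_Y₂ hR
    have hX := h.lie_X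
    have hY := h.lie_Y
    obtain ⟨rfl, rfl, rfl, rfl, rfl, rfl, rfl, hp₁⟩ : r₁ = 0 ∧ s₂ = 0 ∧ s₃ = 0 ∧ s₄ = 0 ∧
        r₃ = 0 ∧ r₄ = 0 ∧ p₃ = 0 ∧ (r₂ + 1 = 0 ∨ p₁ = r₂ + 1) := by
      obtain ⟨⟨a₁, a₂, a₃, a₄⟩, ⟨b₁, b₂, b₃, b₄⟩, ⟨c₁, c₂, c₃, c₄⟩, d₁, d₂, d₃, d₄⟩ :=
        h.jacobi hg hP hR hS
      ring_nf at a₁ a₂ a₃ a₄ b₁ b₂ b₃ b₄ c₁ c₂ c₃ c₄ d₁ d₂ d₃ d₄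
      have e₁ : s₂ = -r₁ := by grind
      have e₂ : s₄ = -r₃ := by grind
      have e₃ : r₁ = 0 := by grind
      have e₄ : s₃ = 0 := by grind
      have e₅ : r₃ = 0 := by grind
      have e₆ : r₄ = 0 := by grind
      have e₇ : p₃ = 0 := by grind
      grind
    subst hs₁
    have hR' : ⁅Y₁, X₂⁆ = -(r₂ • X₂) := by rw [← lie_skew, hR]; module
    have hP' : ⁅Y₁, X₁⁆ = -(p₁ • X₁ + p₂ • X₂ + p₄ • Y₂) := by rw [← lie_skew, hP]; module
    have hS' : ⁅Y₂, X₂⁆ = 0 := by rw [← lie_skew, hS]; module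
    by_cases hr₂ : r₂ + 1 = 0
    · obtain rfl : r₂ = -1 := by linarith
      refine exists_isListed_of_abelian_ideal (X := X₁) (Y := X₂) (Z := Y₂) (W := Y₁) (k := 1)
        (c := -p₁) (a := -p₂) (b := -p₄) (h.generates.change
        ⟨1, 0, 0, 0, by module⟩ ⟨0, 1, 0, 0, by module⟩
        ⟨0, 0, 0, 1, by module⟩ ⟨0, 0, 1, 0, by module⟩) hg ?_ ?_ ?_ ?_ ?_ ?_
      · rw [hX]; module
      · rw [hQ]; module
      · rw [hS]; module
      · rw [hP']; module
      · rw [hR']; module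
      · rw [hY]; module
    · obtain rfl : p₁ = r₂ + 1 := hp₁.resolve_left hr₂
      obtain ⟨i, hi⟩ : ∃ i : ℝ, i * (r₂ + 1) = 1 := ⟨_, inv_mul_cancel₀ hr₂⟩
      refine exists_isListed_of_heisenberg_ideal (X := X₁) (Y := Y₂) (Z := (r₂ + 1) • X₂) (W := Y₁)
        (k := -(r₂ + 1)) (m := 1) (a := -p₄) (b := -(p₂ * i)) (h.generates.change
        ⟨1, 0, 0, 0, by module⟩
        ⟨0, 0, i, 0, by match_scalars <;> first | ring1 | linear_combination -hi⟩
        ⟨0, 0, 0, 1, by module⟩ ⟨0, 1, 0, 0, by module⟩) hg (Or.inr one_ne_zero) ?_ ?_ ?_ ?_ ?_ ?_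
      · rw [hQ]; module
      · rw [lie_smul, hX]; module
      · rw [lie_smul, hS']; module
      · rw [hP']
        match_scalars <;> first | ring1 | linear_combination p₂ * hi
      · rw [hY]; module
      · rw [lie_smul, hR']; module
  · -- `p + t q` is the kernel of the nilpotent endomorphism.
    obtain ⟨t, ht⟩ : ∃ t : ℝ, r₁ + t * s₁ = 0 := ⟨-r₁ / s₁, by field_simp; ring⟩
    have h' : IsFrame (X₁ + t • X₂) X₂ (Y₁ + t • Y₂) Y₂ 0 0 0 1 := by
      simpa using h.changeRight (α := 1) (β := t) (γ := 0) (δ := 1) (by simp)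
    obtain ⟨u₁, u₂, u₃, u₄, hP'⟩ := h'.generates ⁅X₁ + t • X₂, Y₁ + t • Y₂⁆
    have hR' : ⁅X₂, Y₁ + t • Y₂⁆ = (0 : ℝ) • (X₁ + t • X₂) + (r₂ + t * s₂) • X₂ +
        (r₃ + t * s₃) • (Y₁ + t • Y₂) + (r₄ + t * s₄ - t * (r₃ + t * s₃)) • Y₂ := by
      rw [lie_add, lie_smul, hR, hS]
      match_scalars <;> first | ring1 | linear_combination ht
    have hS' : ⁅X₂, Y₂⁆ = s₁ • (X₁ + t • X₂) + (s₂ - t * s₁) • X₂ + s₃ • (Y₁ + t • Y₂) +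
        (s₄ - t * s₃) • Y₂ := by
      rw [hS]; module
    have hQ' := h'.lie_X₁_Y₂ hR'
    have hX' := h'.lie_X
    have hY' := h'.lie_Y
    have hJ := h'.jacobi hg hP' hR' hS'
    clear hP hR hS h
    revert h' hP' hR' hS' hQ' hX' hY' hJ
    generalize X₁ + t • X₂ = X
    generalize Y₁ + t • Y₂ = Y
    generalize r₂ + t * s₂ = v₂
    generalize r₃ + t * s₃ = v₃
    generalize r₄ + t * s₄ - t * v₃ = v₄
    generalize s₂ - t * s₁ = w₂
    generalize s₄ - t * s₃ = w₄
    intro h hP hR hS hQ hX hY ⟨⟨a₁, a₂, a₃, a₄⟩, ⟨b₁, b₂, b₃, b₄⟩, ⟨c₁, c₂, c₃, c₄⟩,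
      d₁, d₂, d₃, d₄⟩
    obtain ⟨rfl, rfl, rfl, rfl, rfl, rfl, rfl, rfl, rfl, rfl⟩ : v₂ = -1 ∧ v₃ = 0 ∧ v₄ = 0 ∧
        w₂ = 0 ∧ s₃ = 0 ∧ w₄ = 0 ∧ u₁ = -2 ∧ u₂ = 0 ∧ u₃ = 0 ∧ u₄ = 0 := by
      ring_nf at a₁ a₂ a₃ a₄ b₁ b₂ b₃ b₄ c₁ c₂ c₃ c₄ d₁ d₂ d₃ d₄
      have e₁ : w₂ = 0 := by grind
      have e₂ : v₂ = -1 := by grind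
      have e₃ : w₄ = -v₃ := by grind
      have e₄ : v₃ = 0 := by grind
      have e₅ : v₄ = 0 := by grind
      have e₆ : s₃ = 0 := by grind
      grind
    obtain ⟨i, hi⟩ : ∃ i : ℝ, i * s₁ = 1 := ⟨_, inv_mul_cancel₀ hs₁⟩
    refine exists_isListed_of_heisenberg_ideal (X := X₂) (Y := Y₂) (Z := s₁ • X) (W := Y)
      (k := 1) (m := 1) (a := 0) (b := 0) (h.generates.change
      ⟨0, 0, i, 0, by match_scalars <;> first | ring1 | linear_combination -hi⟩
      ⟨1, 0, 0, 0, by module⟩ ⟨0, 0, 0, 1, by module⟩ ⟨0, 1, 0, 0, by module⟩) hg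
      (Or.inl one_ne_zero) ?_ ?_ ?_ ?_ ?_ ?_
    · rw [hS]; module
    · rw [lie_smul, ← lie_skew, hX]; module
    · rw [lie_smul, ← lie_skew, hQ]; module
    · rw [← lie_skew, hR]; module
    · rw [hY]; module
    · rw [lie_smul, ← lie_skew, hP]; module

end RankOne

/-! ### Frames with `L` of rank two -/

section RankTwo

variable {g : Type*} [LieRing g] [LieAlgebra ℝ g] {X₁ X₂ Y₁ Y₂ : g}
  {p₁ p₂ p₃ p₄ r₁ r₂ r₃ r₄ s₁ s₂ s₃ s₄ : ℝ}

/-- The case that `X₁ = a ⊗ L a` acts on `V` by a non-zero nilpotent endomorphism that kills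
`L a = p`. The two solutions of the Jacobi identity are `gl(2, ℝ)` and an extension of the
Heisenberg algebra. -/
theorem IsFrame.exists_isListed_of_rank_two_of_p₄_eq_zero (h : IsFrame X₁ X₂ Y₁ Y₂ 1 0 0 1)
    (hg : Module.finrank ℝ g = 4)
    (hP : ⁅X₁, Y₁⁆ = p₁ • X₁ + p₂ • X₂ + p₃ • Y₁ + p₄ • Y₂)
    (hR : ⁅X₂, Y₁⁆ = r₁ • X₁ + r₂ • X₂ + r₃ • Y₁ + r₄ • Y₂)
    (hS : ⁅X₂, Y₂⁆ = s₁ • X₁ + s₂ • X₂ + s₃ • Y₁ + s₄ • Y₂) (hp₄ : p₄ = 0) (hr₃ : r₃ ≠ -1) :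
    ∃ A : ListedAlgebra, IsListed g A := by
  have hQ := h.lie_X₁_Y₂ hR
  have hX := h.lie_X
  have hY := h.lie_Y
  have hX' : ⁅X₂, X₁⁆ = -⁅X₁, X₂⁆ := (lie_skew _ _).symm
  have hY' : ⁅Y₂, Y₁⁆ = -⁅Y₁, Y₂⁆ := (lie_skew _ _).symm
  have hP' : ⁅Y₁, X₁⁆ = -⁅X₁, Y₁⁆ := (lie_skew _ _).symm
  have hR' : ⁅Y₁, X₂⁆ = -⁅X₂, Y₁⁆ := (lie_skew _ _).symm
  have hQ' : ⁅Y₂, X₁⁆ = -⁅X₁, Y₂⁆ := (lie_skew _ _).symm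
  have hS' : ⁅Y₂, X₂⁆ = -⁅X₂, Y₂⁆ := (lie_skew _ _).symm
  subst hp₄
  obtain ⟨rfl, rfl, rfl, hsol⟩ : p₃ = 0 ∧ r₄ = 0 ∧ p₂ = 0 ∧
      ((r₃ = 0 ∧ s₃ = 0 ∧ s₄ = 1 ∧ p₁ = 1 ∧ r₁ = 0 ∧ r₂ = 0 ∧ s₁ = 0 ∧ s₂ = 0) ∨
      (r₃ = -2 ∧ s₃ = -r₁ ∧ s₄ = -1 ∧ p₁ = -1 ∧ r₂ = -2 ∧ s₁ = r₁ ^ 2 ∧ s₂ = -r₁)) := by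
    obtain ⟨⟨a₁, a₂, a₃, a₄⟩, ⟨b₁, b₂, b₃, b₄⟩, ⟨c₁, c₂, c₃, c₄⟩, d₁, d₂, d₃, d₄⟩ :=
      h.jacobi hg hP hR hS
    ring_nf at a₁ a₂ a₃ a₄ b₁ b₂ b₃ b₄ c₁ c₂ c₃ c₄ d₁ d₂ d₃ d₄
    have e₁ : p₃ = -r₄ := by grind
    have e₂ : s₂ = -r₁ := by grind
    have e₃ : p₃ = 0 := by grind
    have e₄ : r₁ ^ 2 + s₁ * (r₂ + 1) = 0 := by grind
    have e₅ : r₃ - p₁ + s₄ - r₂ = 0 := by grind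
    have e₆ : r₄ = 0 := by grind
    have e₇ : r₃ = 0 ∨ r₃ = -2 := by grind
    have e₈ : p₂ = 0 := by grind
    refine ⟨e₃, e₆, e₈, ?_⟩
    rcases e₇ with rfl | rfl
    · left; grind
    · right; grind
  rcases hsol with ⟨rfl, rfl, rfl, rfl, rfl, rfl, rfl, rfl⟩ |
    ⟨rfl, rfl, rfl, rfl, rfl, rfl, rfl⟩
  · refine ⟨.phc2, Generates.isListed (X := (1 / 2 : ℝ) • (X₁ + Y₂))
      (Y := (1 / 2 : ℝ) • (Y₂ - X₁)) (Z := (1 / 2 : ℝ) • (X₂ - Y₁))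
      (W := (1 / 2 : ℝ) • (X₂ + Y₁)) (h.generates.change
      ⟨1, -1, 0, 0, by module⟩ ⟨0, 0, 1, 1, by module⟩ ⟨0, 0, -1, 1, by module⟩
      ⟨1, 1, 0, 0, by module⟩) hg ⟨?_, ?_, ?_, ?_, ?_, ?_⟩⟩ <;>
    simp only [smul_lie, lie_smul, add_lie, lie_add, sub_lie, lie_sub, lie_self, hX', hY', hP',
      hR', hQ', hS', hX, hY, hP, hQ, hR, hS] <;> module
  · refine exists_isListed_of_heisenberg_ideal (X := Y₂) (Y := X₁) (Z := X₂ + Y₁ - r₁ • X₁)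
      (W := X₂ - Y₁) (k := -2) (m := -2) (a := 0) (b := -r₁) (h.generates.change
      ⟨0, 1, 0, 0, by module⟩ ⟨0, r₁ / 2, 1 / 2, 1 / 2, by module⟩
      ⟨0, r₁ / 2, 1 / 2, -1 / 2, by module⟩ ⟨1, 0, 0, 0, by module⟩) hg
      (Or.inl (by norm_num)) ?_ ?_ ?_ ?_ ?_ ?_ <;>
    simp only [lie_smul, lie_add, sub_lie, lie_sub, lie_self, hX', hY', hP',
      hR', hQ', hS', hX, hY, hP, hQ, hR, hS] <;> module

/-- The case that `X₁ = a ⊗ L a` acts on `V` by a nilpotent endomorphism that does not kill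
`L a = p`. If `q` is in its kernel, then the Jacobi identity determines the algebra up to the
parameter `p₄`: it is an extension of the Heisenberg algebra. -/
theorem IsFrame.exists_isListed_of_rank_two_of_p₃_eq_zero (h : IsFrame X₁ X₂ Y₁ Y₂ 1 0 0 1)
    (hg : Module.finrank ℝ g = 4)
    (hP : ⁅X₁, Y₁⁆ = p₁ • X₁ + p₂ • X₂ + p₃ • Y₁ + p₄ • Y₂)
    (hp₃ : p₃ = 0) (hp₄ : p₄ ≠ 0) :
    ∃ A : ListedAlgebra, IsListed g A := by
  obtain ⟨r₁, r₂, r₃, r₄, hR⟩ := h.generates ⁅X₂, Y₁⁆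
  obtain ⟨s₁, s₂, s₃, s₄, hS⟩ := h.generates ⁅X₂, Y₂⁆
  have hQ := h.lie_X₁_Y₂ hR
  have hX := h.lie_X
  have hY := h.lie_Y
  have hX' : ⁅X₂, X₁⁆ = -⁅X₁, X₂⁆ := (lie_skew _ _).symm
  have hY' : ⁅Y₂, Y₁⁆ = -⁅Y₁, Y₂⁆ := (lie_skew _ _).symm
  have hP' : ⁅Y₁, X₁⁆ = -⁅X₁, Y₁⁆ := (lie_skew _ _).symm
  have hR' : ⁅Y₁, X₂⁆ = -⁅X₂, Y₁⁆ := (lie_skew _ _).symm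
  have hQ' : ⁅Y₂, X₁⁆ = -⁅X₁, Y₂⁆ := (lie_skew _ _).symm
  have hS' : ⁅Y₂, X₂⁆ = -⁅X₂, Y₂⁆ := (lie_skew _ _).symm
  subst hp₃
  obtain ⟨rfl, rfl, rfl, rfl, rfl, rfl, rfl, rfl, rfl, hs₁⟩ : r₄ = 0 ∧ r₃ = -1 ∧ s₃ = 0 ∧
      s₄ = -2 ∧ p₁ = -2 ∧ p₂ = 0 ∧ r₁ = 0 ∧ r₂ = -1 ∧ s₂ = 0 ∧ p₄ * s₁ = 1 := by
    obtain ⟨⟨a₁, a₂, a₃, a₄⟩, ⟨b₁, b₂, b₃, b₄⟩, ⟨c₁, c₂, c₃, c₄⟩, d₁, d₂, d₃, d₄⟩ :=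
      h.jacobi hg hP hR hS
    ring_nf at a₁ a₂ a₃ a₄ b₁ b₂ b₃ b₄ c₁ c₂ c₃ c₄ d₁ d₂ d₃ d₄
    have e₁ : r₄ = 0 := by grind
    have e₂ : s₂ = -r₁ := by grind
    have e₃ : r₃ = -1 := by grind
    have e₄ : r₁ ^ 2 + s₁ * (r₂ + 1) = 0 := by grind
    have e₅ : r₃ - p₁ + s₄ - r₂ = 0 := by grind
    have e₆ : s₃ = 0 := by grind
    have e₇ : r₁ = 0 := by grind
    have e₈ : p₂ = 0 := by grind
    have e₉ : r₂ = -1 := by grind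
    grind
  obtain ⟨i, hi⟩ : ∃ i : ℝ, i * p₄ = 1 := ⟨_, inv_mul_cancel₀ hp₄⟩
  refine exists_isListed_of_heisenberg_ideal (X := X₁ + p₄ • Y₂) (Y := X₂ + Y₁)
    (Z := (-2 : ℝ) • X₁ + (2 * p₄) • Y₂) (W := X₂ - Y₁) (k := -2) (m := -2) (a := 0) (b := 0)
    (h.generates.change
    ⟨1 / 2, 0, -1 / 4, 0, by module⟩ ⟨0, 1 / 2, 0, 1 / 2, by module⟩
    ⟨0, 1 / 2, 0, -1 / 2, by module⟩ ⟨i / 2, 0, i / 4, 0, ?_⟩) hg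
    (Or.inl (by norm_num)) ?_ ?_ ?_ ?_ ?_ ?_
  · match_scalars <;> first | ring1 | linear_combination -hi
  all_goals
    simp only [smul_lie, lie_smul, add_lie, lie_add, sub_lie, lie_self, hX', hY', hP',
      hR', hQ', hS', hX, hY, hP, hQ, hR, hS]
    match_scalars <;> first
      | ring1
      | linear_combination 2 * hs₁
      | linear_combination -2 * hs₁
      | linear_combination hs₁
      | linear_combination -hs₁

/-- The case that `X₁ = a ⊗ L a` acts on `V` by a non-zero endomorphism. -/
theorem IsFrame.exists_isListed_of_rank_two_of_action_ne_zero
    (h : IsFrame X₁ X₂ Y₁ Y₂ 1 0 0 1) (hg : Module.finrank ℝ g = 4)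
    (hP : ⁅X₁, Y₁⁆ = p₁ • X₁ + p₂ • X₂ + p₃ • Y₁ + p₄ • Y₂)
    (hR : ⁅X₂, Y₁⁆ = r₁ • X₁ + r₂ • X₂ + r₃ • Y₁ + r₄ • Y₂)
    (hS : ⁅X₂, Y₂⁆ = s₁ • X₁ + s₂ • X₂ + s₃ • Y₁ + s₄ • Y₂) (hne : p₄ ≠ 0 ∨ r₃ ≠ -1) :
    ∃ A : ListedAlgebra, IsListed g A := by
  by_cases hp₄ : p₄ = 0
  · exact h.exists_isListed_of_rank_two_of_p₄_eq_zero hg hP hR hS hp₄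
      (hne.resolve_left (not_not.2 hp₄))
  -- A vector `q + t p` in the kernel takes the place of `q`.
  obtain ⟨t, ht⟩ : ∃ t : ℝ, p₃ - t * p₄ = 0 := ⟨p₃ / p₄, by field_simp; ring⟩
  have h' : IsFrame X₁ (X₂ + t • X₁) (Y₁ + t • X₁) (Y₂ + t • X₂ + t • (Y₁ + t • X₁))
      1 0 0 1 := by
    have := (h.changeLeft (α := 1) (β := 0) (γ := t) (δ := 1) (by simp)).changeRight
      (α := 1) (β := 0) (γ := t) (δ := 1) (by simp)
    convert this using 1 <;> first | ring1 | module
  refine h'.exists_isListed_of_rank_two_of_p₃_eq_zero hg (p₁ := p₁ - t * p₂ - t * p₃ + t ^ 2 * p₄)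
    (p₂ := p₂ - t * p₄) (p₃ := p₃ - t * p₄) (p₄ := p₄) ?_ ht hp₄
  rw [lie_add, lie_smul, lie_self, hP]
  module

/-- The case `L a = p`, `L b = q`. The endomorphisms by which the vectors `c ⊗ L c` act on `V` are
nilpotent; if they all vanish, then the Jacobi identity determines the algebra, and `X₂ - Y₁` acts
on the abelian ideal `⟨X₁, X₂ + Y₁, Y₂⟩` as a scalar. -/
theorem IsFrame.exists_isListed_of_rank_two (h : IsFrame X₁ X₂ Y₁ Y₂ 1 0 0 1)
    (hg : Module.finrank ℝ g = 4) : ∃ A : ListedAlgebra, IsListed g A := by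
  obtain ⟨p₁, p₂, p₃, p₄, hP⟩ := h.generates ⁅X₁, Y₁⁆
  obtain ⟨r₁, r₂, r₃, r₄, hR⟩ := h.generates ⁅X₂, Y₁⁆
  obtain ⟨s₁, s₂, s₃, s₄, hS⟩ := h.generates ⁅X₂, Y₂⁆
  have hQ := h.lie_X₁_Y₂ hR
  by_cases hne : p₄ ≠ 0 ∨ r₃ ≠ -1
  · exact h.exists_isListed_of_rank_two_of_action_ne_zero hg hP hR hS hne
  by_cases hne' : s₁ ≠ 0 ∨ r₂ ≠ -1
  -- The bases `(b, -a)` and `(q, -p)` exchange the roles of `X₁` and `Y₂`.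
  · have h' : IsFrame Y₂ (-Y₁) (-X₂) X₁ 1 0 0 1 := by
      have := (h.changeLeft (α := 0) (β := 1) (γ := -1) (δ := 0) (by simp)).changeRight
        (α := 0) (β := 1) (γ := -1) (δ := 0) (by simp)
      convert this using 1 <;> first | ring1 | module
    refine h'.exists_isListed_of_rank_two_of_action_ne_zero hg
      (p₁ := s₄) (p₂ := -s₃) (p₃ := -s₂) (p₄ := s₁)
      (r₁ := -r₄) (r₂ := r₃) (r₃ := r₂) (r₄ := -r₁)
      (s₁ := p₄) (s₂ := -p₃) (s₃ := -p₂) (s₄ := p₁) ?_ ?_ ?_ hne'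
    · rw [lie_neg, lie_skew, hS]; module
    · rw [neg_lie, lie_neg, neg_neg, ← lie_skew, hR]; module
    · rw [neg_lie, lie_skew, hP]; module
  push Not at hne hne'
  obtain ⟨rfl, rfl⟩ := hne
  obtain ⟨rfl, rfl⟩ := hne'
  obtain ⟨rfl, rfl, rfl, rfl, rfl, rfl, rfl, rfl⟩ : p₁ = -1 ∧ s₃ = 0 ∧ p₂ = 0 ∧ s₄ = -1 ∧
      p₃ = 0 ∧ r₁ = 0 ∧ r₄ = 0 ∧ s₂ = 0 := by
    obtain ⟨⟨a₁, a₂, a₃, a₄⟩, ⟨b₁, b₂, b₃, b₄⟩, ⟨c₁, c₂, c₃, c₄⟩, d₁, d₂, d₃, d₄⟩ :=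
      h.jacobi hg hP hR hS
    ring_nf at a₁ a₂ a₃ a₄ b₁ b₂ b₃ b₄ c₁ c₂ c₃ c₄ d₁ d₂ d₃ d₄
    have e₁ : p₃ = -r₄ := by grind
    have e₂ : s₂ = -r₁ := by grind
    have e₃ : p₃ = 0 := by grind
    have e₄ : r₁ = 0 := by grind
    grind
  have hX := h.lie_X
  have hY := h.lie_Y
  have hP' : ⁅Y₁, X₁⁆ = -⁅X₁, Y₁⁆ := (lie_skew _ _).symm
  have hX' : ⁅X₂, X₁⁆ = -⁅X₁, X₂⁆ := (lie_skew _ _).symm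
  have hR' : ⁅Y₁, X₂⁆ = -⁅X₂, Y₁⁆ := (lie_skew _ _).symm
  refine exists_isListed_of_abelian_ideal (X := X₂ + Y₁) (Y := X₁) (Z := Y₂) (W := X₂ - Y₁)
    (k := -2) (c := -2) (a := 0) (b := 0) (h.generates.change
    ⟨0, 1, 0, 0, by module⟩ ⟨1 / 2, 0, 0, 1 / 2, by module⟩
    ⟨1 / 2, 0, 0, -1 / 2, by module⟩ ⟨0, 0, 1, 0, by module⟩) hg ?_ ?_ ?_ ?_ ?_ ?_ <;>
  simp only [add_lie, lie_add, sub_lie, lie_self, hX', hP', hR', hX, hY, hP, hQ, hR, hS] <;>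
  module

end RankTwo

/-! ### Frames with `L = 0` -/

section RankZero

variable {g : Type*} [LieRing g] [LieAlgebra ℝ g] {X₁ X₂ Y₁ Y₂ : g}
  {p₁ p₂ p₃ p₄ r₁ r₂ r₃ r₄ s₁ s₂ s₃ s₄ : ℝ}

/-- If `X₁ = a ⊗ p` acts on `V` by an invertible endomorphism, then `[X₁, Y₁]` and `[X₁, Y₂]` span
an abelian ideal, and some vector of `a ⊗ V` acts on it as the identity: the commutative associative
product on `V` that comes from the action of `a ⊗ V` has a unit. -/
theorem IsFrame.exists_isListed_of_det_ne_zero (h : IsFrame X₁ X₂ Y₁ Y₂ 0 0 0 0)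
    (hg : Module.finrank ℝ g = 4)
    (hP : ⁅X₁, Y₁⁆ = p₁ • X₁ + p₂ • X₂ + p₃ • Y₁ + p₄ • Y₂)
    (hR : ⁅X₂, Y₁⁆ = r₁ • X₁ + r₂ • X₂ + r₃ • Y₁ + r₄ • Y₂)
    (hS : ⁅X₂, Y₂⁆ = s₁ • X₁ + s₂ • X₂ + s₃ • Y₁ + s₄ • Y₂)
    (hdet : p₃ * r₄ - r₃ * p₄ ≠ 0) : ∃ A : ListedAlgebra, IsListed g A := by
  obtain ⟨i, hi⟩ : ∃ i : ℝ, i * (p₃ * r₄ - r₃ * p₄) = 1 := ⟨_, inv_mul_cancel₀ hdet⟩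
  have hX : ⁅X₁, X₂⁆ = 0 := by rw [h.lie_X]; module
  have hY : ⁅Y₁, Y₂⁆ = 0 := by rw [h.lie_Y]; module
  have hX' : ⁅X₂, X₁⁆ = 0 := lie_eq_zero_comm hX
  have hY' : ⁅Y₂, Y₁⁆ = 0 := lie_eq_zero_comm hY
  have hXY : ⁅X₁, Y₂⁆ = ⁅X₂, Y₁⁆ := by
    rw [← sub_eq_zero, h.lie_XY]; module
  obtain ⟨P, hP₀⟩ : ∃ P, ⁅X₁, Y₁⁆ = P := ⟨_, rfl⟩
  obtain ⟨R, hR₀⟩ : ∃ R, ⁅X₂, Y₁⁆ = R := ⟨_, rfl⟩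
  obtain ⟨S, hS₀⟩ : ∃ S, ⁅X₂, Y₂⁆ = S := ⟨_, rfl⟩
  rw [hP₀] at hP
  rw [hR₀] at hR hXY
  rw [hS₀] at hS
  have hP' : ⁅Y₁, X₁⁆ = -P := by rw [← lie_skew, hP₀]
  have hR' : ⁅Y₁, X₂⁆ = -R := by rw [← lie_skew, hR₀]
  have hQ' : ⁅Y₂, X₁⁆ = -R := by rw [← lie_skew, hXY]
  have hS' : ⁅Y₂, X₂⁆ = -S := by rw [← lie_skew, hS₀]
  have hX₁P : ⁅X₁, P⁆ = p₃ • P + p₄ • R := by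
    rw [hP]; simp only [lie_add, lie_smul, lie_self, hX, hP₀, hXY]; rw [← hP]; module
  have hX₂P : ⁅X₂, P⁆ = p₃ • R + p₄ • S := by
    rw [hP]; simp only [lie_add, lie_smul, lie_self, hX', hR₀, hS₀]; module
  have hX₁R : ⁅X₁, R⁆ = r₃ • P + r₄ • R := by
    rw [hR]; simp only [lie_add, lie_smul, lie_self, hX, hP₀, hXY]; rw [← hR]; module
  have hX₂R : ⁅X₂, R⁆ = r₃ • R + r₄ • S := by
    rw [hR]; simp only [lie_add, lie_smul, lie_self, hX', hR₀, hS₀]; rw [← hR]; module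
  have hX₁S : ⁅X₁, S⁆ = s₃ • P + s₄ • R := by
    rw [hS]; simp only [lie_add, lie_smul, lie_self, hX, hP₀, hXY]; module
  have hY₁R : ⁅Y₁, R⁆ = -(r₁ • P) - r₂ • R := by
    rw [hR]; simp only [lie_add, lie_smul, lie_self, hY, hP', hR']; rw [← hR]; module
  have hY₂R : ⁅Y₂, R⁆ = -(r₁ • R) - r₂ • S := by
    rw [hR]; simp only [lie_add, lie_smul, lie_self, hY', hQ', hS']; rw [← hR]; module
  have hJ₁ : r₃ • P + r₄ • R = p₃ • R + p₄ • S := by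
    have := leibniz_lie X₁ X₂ Y₁
    rwa [hX, zero_lie, zero_add, hP₀, hR₀, hX₁R, hX₂P] at this
  have hJ₂ : s₃ • P + s₄ • R = r₃ • R + r₄ • S := by
    have := leibniz_lie X₁ X₂ Y₂
    rwa [hX, zero_lie, zero_add, hXY, hS₀, hX₁S, hX₂R] at this
  obtain ⟨u, v, hSuv⟩ : ∃ u v : ℝ, S = u • P + v • R := by
    by_cases hp₄ : p₄ = 0
    · have hr₄ : r₄ ≠ 0 := by rintro rfl; simp [hp₄] at hdet
      refine ⟨s₃ / r₄, (s₄ - r₃) / r₄, ?_⟩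
      have : S = r₄⁻¹ • (s₃ • P + s₄ • R - r₃ • R) := by
        rw [hJ₂, add_sub_cancel_left, inv_smul_smul₀ hr₄]
      rw [this]; module
    · refine ⟨r₃ / p₄, (r₄ - p₃) / p₄, ?_⟩
      have : S = p₄⁻¹ • (r₃ • P + r₄ • R - p₃ • R) := by
        rw [hJ₁, add_sub_cancel_left, inv_smul_smul₀ hp₄]
      rw [this]; module
  obtain ⟨Z, hZ⟩ : ∃ Z, Z = -(i • (r₄ • X₁ - p₄ • X₂)) := ⟨_, rfl⟩
  have hPZ : ⁅P, Z⁆ = P := by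
    rw [← lie_skew, hZ, neg_lie, smul_lie, sub_lie, smul_lie, smul_lie, hX₁P, hX₂P, ← hJ₁, neg_neg]
    match_scalars <;> first | ring1 | linear_combination hi
  have hRZ : ⁅R, Z⁆ = R := by
    rw [← lie_skew, hZ, neg_lie, smul_lie, sub_lie, smul_lie, smul_lie, hX₁R, hX₂R, neg_neg,
      show p₄ • (r₃ • R + r₄ • S) = (p₄ * r₃ - r₄ * p₃) • R + r₄ • (p₃ • R + p₄ • S) by module,
      ← hJ₁]
    match_scalars <;> first | ring1 | linear_combination hi
  have hPR : ⁅P, R⁆ = 0 := by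
    -- `Z` acts as the identity on this bracket because it lies in the ideal, and as twice the
    -- identity because the action is a derivation.
    have hmem : ∃ x y : ℝ, ⁅P, R⁆ = x • P + y • R := by
      refine ⟨p₁ * r₃ + p₂ * r₄ * u - p₃ * r₁ - p₄ * r₂ * u,
        p₁ * r₄ + p₂ * (r₃ + r₄ * v) - p₃ * r₂ - p₄ * (r₁ + r₂ * v), ?_⟩
      nth_rewrite 1 [hP]
      simp only [add_lie, smul_lie, hX₁R, hX₂R, hY₁R, hY₂R, hSuv]
      module
    obtain ⟨x, y, hxy⟩ := hmem
    have h₁ : ⁅⁅P, R⁆, Z⁆ = ⁅P, R⁆ := by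
      rw [hxy, add_lie, smul_lie, smul_lie, hPZ, hRZ]
    rw [lie_lie, hRZ, hPZ, ← lie_skew R P, sub_neg_eq_add] at h₁
    exact add_eq_left.1 h₁
  have hgen : Generates X₁ X₂ P R := h.generates.change
    ⟨1, 0, 0, 0, by module⟩ ⟨0, 1, 0, 0, by module⟩
    ⟨-(i * (r₄ * p₁ - p₄ * r₁)), -(i * (r₄ * p₂ - p₄ * r₂)), i * r₄, -(i * p₄), by
      rw [hP, hR]; match_scalars <;> first | ring1 | linear_combination -hi⟩
    ⟨-(i * (p₃ * r₁ - r₃ * p₁)), -(i * (p₃ * r₂ - r₃ * p₂)), -(i * r₃), i * p₃, by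
      rw [hP, hR]; match_scalars <;> first | ring1 | linear_combination -hi⟩
  have hZX : ⁅Z, X₁⁆ = 0 ∧ ⁅Z, X₂⁆ = 0 := by
    rw [hZ]
    simp only [neg_lie, smul_lie, sub_lie, lie_self, hX, hX']
    simp
  by_cases hp₄ : p₄ = 0
  · have hr₄ : r₄ ≠ 0 := by rintro rfl; simp [hp₄] at hdet
    refine exists_isListed_of_scalar_action (X := P) (Y := R) (Z := Z) (W := -X₂)
      (r := p₄ * u) (s := p₃ + p₄ * v) (t := r₄ * u) (u := r₃ + r₄ * v)
      (hgen.change ⟨0, 0, -p₃, 0, ?_⟩ ⟨0, 0, 0, -1, by module⟩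
        ⟨1, 0, 0, 0, by module⟩ ⟨0, 1, 0, 0, by module⟩) hg hPR (by rw [lie_neg, hZX.2, neg_zero])
      hPZ hRZ ?_ ?_
    · rw [hZ]
      subst hp₄
      match_scalars <;> first | ring1 | linear_combination -hi
    · rw [lie_neg, lie_skew, hX₂P, hSuv]; module
    · rw [lie_neg, lie_skew, hX₂R, hSuv]; module
  · obtain ⟨j, hj⟩ : ∃ j : ℝ, j * p₄ = 1 := ⟨_, inv_mul_cancel₀ hp₄⟩
    refine exists_isListed_of_scalar_action (X := P) (Y := R) (Z := Z) (W := -X₁)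
      (r := p₃) (s := p₄) (t := r₃) (u := r₄)
      (hgen.change ⟨0, 0, 0, -1, by module⟩
        ⟨0, 0, j * (p₃ * r₄ - r₃ * p₄), -(j * r₄), ?_⟩
        ⟨1, 0, 0, 0, by module⟩ ⟨0, 1, 0, 0, by module⟩) hg hPR (by rw [lie_neg, hZX.1, neg_zero])
      hPZ hRZ ?_ ?_
    · rw [hZ]
      match_scalars <;>
        first | ring1 | linear_combination j * r₄ * hi | linear_combination -hj - j * p₄ * hi
    · rw [lie_neg, lie_skew, hX₁P]
    · rw [lie_neg, lie_skew, hX₁R]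

/-- If no decomposable vector `c ⊗ v` acts on `V` by an invertible endomorphism, then the minors of
the matrix with the columns `[X₁, Y₁]`, `[X₁, Y₂]`, `[X₂, Y₂]` that belong to the rows of
`a ⊗ V` and of `b ⊗ V`, and their polarisations, vanish. -/
theorem IsFrame.minors_eq_zero (hnot : ¬∃ A : ListedAlgebra, IsListed g A)
    (h : IsFrame X₁ X₂ Y₁ Y₂ 0 0 0 0) (hg : Module.finrank ℝ g = 4)
    (hP : ⁅X₁, Y₁⁆ = p₁ • X₁ + p₂ • X₂ + p₃ • Y₁ + p₄ • Y₂)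
    (hR : ⁅X₂, Y₁⁆ = r₁ • X₁ + r₂ • X₂ + r₃ • Y₁ + r₄ • Y₂)
    (hS : ⁅X₂, Y₂⁆ = s₁ • X₁ + s₂ • X₂ + s₃ • Y₁ + s₄ • Y₂) :
    (p₃ * r₄ = r₃ * p₄ ∧ p₃ * s₄ = s₃ * p₄ ∧ r₃ * s₄ = s₃ * r₄) ∧
    (p₁ * r₂ = r₁ * p₂ ∧ p₁ * s₂ = s₁ * p₂ ∧ r₁ * s₂ = s₁ * r₂) ∧
    p₃ * r₂ + p₁ * r₄ = r₃ * p₂ + r₁ * p₄ ∧ p₃ * s₂ + p₁ * s₄ = s₃ * p₂ + s₁ * p₄ ∧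
    r₃ * s₂ + r₁ * s₄ = s₃ * r₂ + s₁ * r₄ := by
  -- The determinant of the action of `(a + t b) ⊗ (p + s q)`.
  have key : ∀ t s : ℝ,
      ((p₃ - t * p₁) + 2 * s * (r₃ - t * r₁) + s ^ 2 * (s₃ - t * s₁)) *
        ((r₄ - t * r₂) + s * (s₄ - t * s₂)) -
      ((r₃ - t * r₁) + s * (s₃ - t * s₁)) *
        ((p₄ - t * p₂) + 2 * s * (r₄ - t * r₂) + s ^ 2 * (s₄ - t * s₂)) = 0 := by
    intro t s
    have hQ := h.lie_X₁_Y₂ hR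
    have hY : ⁅Y₁, Y₂⁆ = 0 := by rw [h.lie_Y]; module
    have hY' : ⁅Y₂, Y₁⁆ = 0 := lie_eq_zero_comm hY
    have h' := (h.changeLeft (α := 1) (β := t) (γ := 0) (δ := 1) (by simp)).changeRight
      (α := 1) (β := s) (γ := 0) (δ := 1) (by simp)
    have h'' : IsFrame (X₁ + t • Y₁ + s • (X₂ + t • Y₂)) (X₂ + t • Y₂) (Y₁ + s • Y₂) Y₂
        0 0 0 0 := by
      convert h' using 1 <;> first | ring1 | module
    by_contra hne
    refine hnot (h''.exists_isListed_of_det_ne_zero hg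
      (p₁ := p₁ + 2 * s * r₁ + s ^ 2 * s₁)
      (p₂ := (p₂ + 2 * s * r₂ + s ^ 2 * s₂) - s * (p₁ + 2 * s * r₁ + s ^ 2 * s₁))
      (p₃ := (p₃ - t * p₁) + 2 * s * (r₃ - t * r₁) + s ^ 2 * (s₃ - t * s₁))
      (p₄ := (p₄ - t * p₂) + 2 * s * (r₄ - t * r₂) + s ^ 2 * (s₄ - t * s₂) -
        s * ((p₃ - t * p₁) + 2 * s * (r₃ - t * r₁) + s ^ 2 * (s₃ - t * s₁)))
      (r₁ := r₁ + s * s₁) (r₂ := r₂ + s * s₂ - s * (r₁ + s * s₁))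
      (r₃ := (r₃ - t * r₁) + s * (s₃ - t * s₁))
      (r₄ := (r₄ - t * r₂) + s * (s₄ - t * s₂) - s * ((r₃ - t * r₁) + s * (s₃ - t * s₁)))
      (s₁ := s₁) (s₂ := s₂ - s * s₁) (s₃ := s₃ - t * s₁)
      (s₄ := s₄ - t * s₂ - s * (s₃ - t * s₁)) ?_ ?_ ?_ ?_)
    · simp only [add_lie, lie_add, smul_lie, lie_smul, lie_self, hY, hY', hP, hQ, hR, hS]; module
    · simp only [add_lie, lie_add, smul_lie, lie_smul, lie_self, hY', hR, hS]; module
    · simp only [add_lie, smul_lie, lie_self, hS]; module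
    · intro h0
      refine hne ?_
      linear_combination h0
  have k₁ := key 0 0
  have k₂ := key 0 1
  have k₃ := key 0 (-1)
  have k₄ := key 1 0
  have k₅ := key 1 1
  have k₆ := key 1 (-1)
  have k₇ := key (-1) 0
  have k₈ := key (-1) 1
  have k₉ := key (-1) (-1)
  refine ⟨⟨?_, ?_, ?_⟩, ⟨?_, ?_, ?_⟩, ?_, ?_, ?_⟩ <;> linarith

/-- If the three mixed brackets are `v`, `k v` and `k² v`, then the derived algebra is spanned by
`v`. -/
theorem IsFrame.exists_isListed_of_proportional (h : IsFrame X₁ X₂ Y₁ Y₂ 0 0 0 0)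
    (hg : Module.finrank ℝ g = 4) {k : ℝ} (hR : ⁅X₂, Y₁⁆ = k • ⁅X₁, Y₁⁆)
    (hS : ⁅X₂, Y₂⁆ = k ^ 2 • ⁅X₁, Y₁⁆) : ∃ A : ListedAlgebra, IsListed g A := by
  have hX : ⁅X₁, X₂⁆ = 0 := by rw [h.lie_X]; module
  have hY : ⁅Y₁, Y₂⁆ = 0 := by rw [h.lie_Y]; module
  have hX' : ⁅X₂, X₁⁆ = 0 := lie_eq_zero_comm hX
  have hY' : ⁅Y₂, Y₁⁆ = 0 := lie_eq_zero_comm hY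
  have hQ : ⁅X₁, Y₂⁆ = k • ⁅X₁, Y₁⁆ := by
    rw [← hR, ← sub_eq_zero, h.lie_XY]; module
  have hQ' : ⁅Y₂, X₁⁆ = -(k • ⁅X₁, Y₁⁆) := by rw [← lie_skew, hQ]
  have hR' : ⁅Y₁, X₂⁆ = -(k • ⁅X₁, Y₁⁆) := by rw [← lie_skew, hR]
  have hS' : ⁅Y₂, X₂⁆ = -(k ^ 2 • ⁅X₁, Y₁⁆) := by rw [← lie_skew, hS]
  have hP' : ⁅Y₁, X₁⁆ = -⁅X₁, Y₁⁆ := (lie_skew _ _).symm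
  -- `X₂ - k X₁` and `Y₂ - k Y₁` are central.
  have hgen : Generates X₁ (X₂ - k • X₁) Y₁ (Y₂ - k • Y₁) := h.generates.change
    ⟨1, 0, 0, 0, by module⟩ ⟨k, 1, 0, 0, by module⟩
    ⟨0, 0, 1, 0, by module⟩ ⟨0, 0, k, 1, by module⟩
  have c₁ : ⁅X₁, X₂ - k • X₁⁆ = 0 := by
    simp only [lie_sub, lie_smul, lie_self, hX]; module
  have c₂ : ⁅Y₁, X₂ - k • X₁⁆ = 0 := by
    simp only [lie_sub, lie_smul, hR', hP']; module
  have c₃ : ⁅X₁, Y₂ - k • Y₁⁆ = 0 := by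
    simp only [lie_sub, lie_smul, hQ]; module
  have c₄ : ⁅Y₁, Y₂ - k • Y₁⁆ = 0 := by
    simp only [lie_sub, lie_smul, lie_self, hY]; module
  have c₅ : ⁅X₂ - k • X₁, Y₂ - k • Y₁⁆ = 0 := by
    simp only [lie_sub, sub_lie, smul_lie, lie_smul, hR, hS, hQ]; module
  revert hgen c₁ c₂ c₃ c₄ c₅
  generalize X₂ - k • X₁ = U
  generalize Y₂ - k • Y₁ = V
  intro hgen c₁ c₂ c₃ c₄ c₅
  obtain ⟨p₁, p₂, p₃, p₄, hP⟩ := hgen ⁅X₁, Y₁⁆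
  by_cases hp₁ : p₁ = 0
  · subst hp₁
    refine exists_isListed_of_abelian_ideal (X := Y₁) (Y := U) (Z := V) (W := X₁) (k := 0)
      (c := p₃) (a := p₂) (b := p₄) (hgen.change ⟨0, 0, 0, 1, by module⟩ ⟨0, 1, 0, 0, by module⟩
      ⟨1, 0, 0, 0, by module⟩ ⟨0, 0, 1, 0, by module⟩) hg c₂ c₄ c₅ ?_ ?_ ?_
    · rw [hP]; module
    · rw [c₁, zero_smul]
    · rw [c₃, zero_smul]
  · obtain ⟨i, hi⟩ : ∃ i : ℝ, i * p₁ = 1 := ⟨_, inv_mul_cancel₀ hp₁⟩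
    refine exists_isListed_of_abelian_ideal (X := ⁅X₁, Y₁⁆) (Y := U) (Z := V) (W := Y₁) (k := 0)
      (c := -p₁) (a := 0) (b := 0) (hgen.change
      ⟨i, -(i * p₂), -(i * p₄), -(i * p₃), ?_⟩ ⟨0, 1, 0, 0, by module⟩
      ⟨0, 0, 0, 1, by module⟩ ⟨0, 0, 1, 0, by module⟩) hg ?_ ?_ c₅ ?_ ?_ ?_
    · rw [hP]
      match_scalars <;> first | ring1 | linear_combination -hi
    · rw [lie_lie, c₁, c₂, lie_zero, lie_zero, sub_zero]
    · rw [lie_lie, c₃, c₄, lie_zero, lie_zero, sub_zero]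
    · nth_rewrite 1 [hP]
      simp only [lie_add, lie_smul, lie_self, c₂, c₄, hP']
      module
    · rw [c₂, zero_smul]
    · rw [c₄, zero_smul]

/-- If `[X₁, Y₁]` has a non-zero component in `b ⊗ V`, then either the vanishing of the minors
forces the derived algebra to be one-dimensional, or a minor does not vanish. -/
theorem IsFrame.exists_isListed_of_rank_zero_of_ne_zero (h : IsFrame X₁ X₂ Y₁ Y₂ 0 0 0 0)
    (hg : Module.finrank ℝ g = 4)
    (hP : ⁅X₁, Y₁⁆ = p₁ • X₁ + p₂ • X₂ + p₃ • Y₁ + p₄ • Y₂) (hne : p₃ ≠ 0 ∨ p₄ ≠ 0) :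
    ∃ A : ListedAlgebra, IsListed g A := by
  by_contra hnot
  obtain ⟨r₁, r₂, r₃, r₄, hR⟩ := h.generates ⁅X₂, Y₁⁆
  obtain ⟨s₁, s₂, s₃, s₄, hS⟩ := h.generates ⁅X₂, Y₂⁆
  obtain ⟨⟨f₁, f₂, f₃⟩, ⟨f₄, f₅, f₆⟩, f₇, f₈, f₉⟩ := h.minors_eq_zero hnot hg hP hR hS
  obtain ⟨⟨a₁, a₂, a₃, a₄⟩, ⟨b₁, b₂, b₃, b₄⟩, ⟨c₁, c₂, c₃, c₄⟩, d₁, d₂, d₃, d₄⟩ :=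
    h.jacobi hg hP hR hS
  ring_nf at a₁ a₂ a₃ a₄ b₁ b₂ b₃ b₄ c₁ c₂ c₃ c₄ d₁ d₂ d₃ d₄
  refine hnot ?_
  obtain ⟨k, e₁, e₂, e₃, e₄, e₅, e₆, e₇, e₈⟩ : ∃ k : ℝ, r₁ = k * p₁ ∧ r₂ = k * p₂ ∧
      r₃ = k * p₃ ∧ r₄ = k * p₄ ∧ s₁ = k ^ 2 * p₁ ∧ s₂ = k ^ 2 * p₂ ∧ s₃ = k ^ 2 * p₃ ∧
      s₄ = k ^ 2 * p₄ := by
    by_cases hp₄ : p₄ = 0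
    · have hp₃ : p₃ ≠ 0 := hne.resolve_right (not_not.2 hp₄)
      obtain ⟨k, rfl⟩ : ∃ k : ℝ, r₃ = k * p₃ := ⟨r₃ / p₃, by field_simp⟩
      have e₁ : r₁ = k * p₁ := by grind
      have e₂ : r₂ = k * p₂ := by grind
      have e₃ : r₄ = k * p₄ := by grind
      have e₄ : s₁ = k ^ 2 * p₁ := by grind
      have e₅ : s₂ = k ^ 2 * p₂ := by grind
      have e₆ : s₃ = k ^ 2 * p₃ := by grind
      have e₇ : s₄ = k ^ 2 * p₄ := by grind
      exact ⟨k, e₁, e₂, rfl, e₃, e₄, e₅, e₆, e₇⟩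
    · obtain ⟨k, rfl⟩ : ∃ k : ℝ, r₄ = k * p₄ := ⟨r₄ / p₄, by field_simp⟩
      have e₁ : r₁ = k * p₁ := by grind
      have e₂ : r₂ = k * p₂ := by grind
      have e₃ : r₃ = k * p₃ := by grind
      have e₄ : s₁ = k ^ 2 * p₁ := by grind
      have e₅ : s₂ = k ^ 2 * p₂ := by grind
      have e₆ : s₃ = k ^ 2 * p₃ := by grind
      have e₇ : s₄ = k ^ 2 * p₄ := by grind
      exact ⟨k, e₁, e₂, e₃, rfl, e₄, e₅, e₆, e₇⟩
  refine h.exists_isListed_of_proportional hg (k := k) ?_ ?_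
  · rw [hR, hP, e₁, e₂, e₃, e₄]; module
  · rw [hS, hP, e₅, e₆, e₇, e₈]; module

theorem IsFrame.exists_isListed_of_rank_zero_of_lie_ne_zero (h : IsFrame X₁ X₂ Y₁ Y₂ 0 0 0 0)
    (hg : Module.finrank ℝ g = 4) (hne : ⁅X₁, Y₁⁆ ≠ 0) : ∃ A : ListedAlgebra, IsListed g A := by
  obtain ⟨p₁, p₂, p₃, p₄, hP⟩ := h.generates ⁅X₁, Y₁⁆
  by_cases hp : p₃ ≠ 0 ∨ p₄ ≠ 0
  · exact h.exists_isListed_of_rank_zero_of_ne_zero hg hP hp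
  · push Not at hp
    have h' : IsFrame Y₁ Y₂ X₁ X₂ 0 0 0 0 := by
      simpa using h.changeLeft (α := 0) (β := 1) (γ := 1) (δ := 0) (by simp)
    refine h'.exists_isListed_of_rank_zero_of_ne_zero hg (p₁ := -p₃) (p₂ := -p₄) (p₃ := -p₁)
      (p₄ := -p₂) ?_ ?_
    · rw [← lie_skew, hP]; module
    · by_contra! h0
      simp only [neg_eq_zero] at h0
      exact hne (by rw [hP, hp.1, hp.2, h0.1, h0.2]; module)

/-- The case `L = 0`. The mixed brackets are the polarisation of the quadratic map
`v ↦ [a ⊗ v, b ⊗ v]`; if this vanishes, then the algebra is abelian. -/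
theorem IsFrame.exists_isListed_of_rank_zero (h : IsFrame X₁ X₂ Y₁ Y₂ 0 0 0 0)
    (hg : Module.finrank ℝ g = 4) : ∃ A : ListedAlgebra, IsListed g A := by
  by_cases hP : ⁅X₁, Y₁⁆ = 0
  swap
  · exact h.exists_isListed_of_rank_zero_of_lie_ne_zero hg hP
  by_cases hS : ⁅X₂, Y₂⁆ = 0
  swap
  · have h' : IsFrame X₂ X₁ Y₂ Y₁ 0 0 0 0 := by
      simpa using h.changeRight (α := 0) (β := 1) (γ := 1) (δ := 0) (by simp)
    exact h'.exists_isListed_of_rank_zero_of_lie_ne_zero hg hS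
  have hQ : ⁅X₁, Y₂⁆ = ⁅X₂, Y₁⁆ := by
    rw [← sub_eq_zero, h.lie_XY]; module
  by_cases hR : ⁅X₂, Y₁⁆ = 0
  · refine h.exists_isListed_of_proportional hg (k := 0) ?_ ?_
    · rw [hR, zero_smul]
    · rw [hS, hP, smul_zero]
  · have h' : IsFrame (X₁ + X₂) X₂ (Y₁ + Y₂) Y₂ 0 0 0 0 := by
      simpa using h.changeRight (α := 1) (β := 1) (γ := 0) (δ := 1) (by simp)
    refine h'.exists_isListed_of_rank_zero_of_lie_ne_zero hg fun h0 ↦ hR ?_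
    have : (2 : ℝ) • ⁅X₂, Y₁⁆ = 0 := by
      rw [← h0, add_lie, lie_add, lie_add, hP, hS, hQ]; module
    simpa using this

end RankZero

/-! ### The classification -/

section Classification

variable {g : Type*} [LieRing g] [LieAlgebra ℝ g] {X₁ X₂ Y₁ Y₂ : g} {l₁ l₂ l₃ l₄ : ℝ}

/-- The bases of `R` and `V` can be chosen such that `L` is in normal form. -/
theorem IsFrame.exists_isListed (h : IsFrame X₁ X₂ Y₁ Y₂ l₁ l₂ l₃ l₄)
    (hg : Module.finrank ℝ g = 4) : ∃ A : ListedAlgebra, IsListed g A := by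
  -- A frame with `L a = 0` and `L b ≠ 0`.
  have hone : ∀ {X₁ X₂ Y₁ Y₂ : g} {m n : ℝ}, IsFrame X₁ X₂ Y₁ Y₂ 0 0 m n →
      m ^ 2 + n ^ 2 ≠ 0 → ∃ A : ListedAlgebra, IsListed g A := by
    intro X₁ X₂ Y₁ Y₂ m n h hmn
    obtain ⟨i, hi⟩ : ∃ i : ℝ, i * (m ^ 2 + n ^ 2) = 1 := ⟨_, inv_mul_cancel₀ hmn⟩
    have h' := h.changeRight (α := i * n) (β := -(i * m)) (γ := m) (δ := n) (by
      have : i * n * n - -(i * m) * m = 1 := by linear_combination hi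
      rw [this]; exact one_ne_zero)
    rw [show n * 0 - m * 0 = 0 by ring, show i * n * 0 - -(i * m) * 0 = 0 by ring,
      show n * m - m * n = 0 by ring,
      show i * n * n - -(i * m) * m = 1 by linear_combination hi] at h'
    exact h'.exists_isListed_of_rank_one hg
  by_cases hdet : l₁ * l₄ - l₂ * l₃ = 0
  · by_cases hb : l₃ ^ 2 + l₄ ^ 2 = 0
    · obtain ⟨rfl, rfl⟩ : l₃ = 0 ∧ l₄ = 0 := by
        constructor <;> nlinarith [sq_nonneg l₃, sq_nonneg l₄]
      by_cases ha : l₁ ^ 2 + l₂ ^ 2 = 0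
      · obtain ⟨rfl, rfl⟩ : l₁ = 0 ∧ l₂ = 0 := by
          constructor <;> nlinarith [sq_nonneg l₁, sq_nonneg l₂]
        exact h.exists_isListed_of_rank_zero hg
      · refine hone (m := l₁) (n := l₂) (X₁ := Y₁) (X₂ := Y₂) (Y₁ := X₁) (Y₂ := X₂) ?_ ha
        simpa using h.changeLeft (α := 0) (β := 1) (γ := 1) (δ := 0) (by simp)
    · obtain ⟨i, hi⟩ : ∃ i : ℝ, i * (l₃ ^ 2 + l₄ ^ 2) = 1 := ⟨_, inv_mul_cancel₀ hb⟩
      -- `L a = k L b`.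
      obtain ⟨k, h₁, h₂⟩ : ∃ k : ℝ, l₁ = k * l₃ ∧ l₂ = k * l₄ := by
        refine ⟨i * (l₁ * l₃ + l₂ * l₄), ?_, ?_⟩
        · linear_combination -l₁ * hi + i * l₄ * hdet
        · linear_combination -l₂ * hi - i * l₃ * hdet
      have h' := h.changeLeft (α := 1) (β := -k) (γ := 0) (δ := 1) (by simp)
      rw [show 1 * l₁ + -k * l₃ = 0 by linear_combination h₁,
        show 1 * l₂ + -k * l₄ = 0 by linear_combination h₂,
        show 0 * l₁ + 1 * l₃ = l₃ by ring, show 0 * l₂ + 1 * l₄ = l₄ by ring] at h'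
      exact hone h' hb
  · obtain ⟨i, hi⟩ : ∃ i : ℝ, i * (l₁ * l₄ - l₂ * l₃) = 1 := ⟨_, inv_mul_cancel₀ hdet⟩
    have hi0 : i ≠ 0 := left_ne_zero_of_mul_eq_one hi
    -- The factor `i` compensates for the change of the area form of `V`.
    have h' := (h.changeRight (α := l₁) (β := l₂) (γ := l₃) (δ := l₄) hdet).changeLeft
      (α := i) (β := 0) (γ := 0) (δ := i) (by simpa using hi0)
    rw [show i * (l₄ * l₁ - l₃ * l₂) + 0 * (l₄ * l₃ - l₃ * l₄) = 1 by linear_combination hi,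
      show i * (l₁ * l₂ - l₂ * l₁) + 0 * (l₁ * l₄ - l₂ * l₃) = 0 by ring,
      show 0 * (l₄ * l₁ - l₃ * l₂) + i * (l₄ * l₃ - l₃ * l₄) = 0 by ring,
      show 0 * (l₁ * l₂ - l₂ * l₁) + i * (l₁ * l₄ - l₂ * l₃) = 1 by linear_combination hi] at h'
    exact h'.exists_isListed_of_rank_two hg

end Classification

end ParaHypercomplex

/-- Each of the ten families of commutator relations defines a Lie algebra for all admissible
values of the parameters, and a four-dimensional real Lie algebra admits an integrable
para-hypercomplex structure if and only if it is isomorphic to a member of one of them. -/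
theorem theorem1p1 :
    (∀ A : ParaHypercomplex.ListedAlgebra,
      ∃ (h : Type) (_ : LieRing h) (_ : LieAlgebra ℝ h), ParaHypercomplex.IsListed h A) ∧
    (∀ (g : Type*) [LieRing g] [LieAlgebra ℝ g], Module.finrank ℝ g = 4 →
      (ParaHypercomplex.AdmitsIntegrableParaHypercomplex g ↔
        ∃ A : ParaHypercomplex.ListedAlgebra, ParaHypercomplex.IsListed g A)) := by
  refine ⟨fun A ↦ ⟨ParaHypercomplex.Model A, inferInstance, inferInstance,
    ParaHypercomplex.Model.isListed A⟩, fun g _ _ hg ↦ ⟨?_, fun ⟨A, hA⟩ ↦ hA.admits hg⟩⟩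
  rintro ⟨J₁, J₂, hJ⟩
  obtain ⟨X₁, X₂, Y₁, Y₂, l₁, l₂, l₃, l₄, h⟩ :=
    ParaHypercomplex.exists_isFrame_of_integrable hg hJ
  exact h.exists_isListed hg
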